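/- **Setting.** For $f\in L^2(\mathbb R)$ let $\hat f(\xi)=\frac1{\sqrt{2\pi}}\int e^{-ix\xi}f(x)\,dx$, $\|f\|_{H^s}=\|(1+|\xi|^2)^{s/2}\hat f\|_{L^2}$, $\|f\|_{\dot H^{-1}}=\||\xi|^{-1}\hat f\|_{L^2}$ and $\partial_x^{-1}f=\mathcal F^{-1}[\hat f/(i\xi)]$. For $u=u(t,x)$ real-valued put $J=x-t\partial_x^{-2}$, so that $J\partial_xu=xu_x-t\partial_x^{-1}u$, and $$\|u(t)\|_{X^s}=\left(\|u(t)\|_{H^s}^2+\|u(t)\|_{\dot H^{-1}}^2+\|J\partial_xu(t)\|_{L^2}^2\right)^{1/2}.$$ Let $\delta=\frac1{1000}$ and fix a smooth $\chi:\mathbb R\to\mathbb C$ with $\operatorname{supp}\chi\subset[-1+2^{-\delta},1-2^{-\delta}]$ and $\int_{\mathbb R}\chi\,dx=1$. For $t\ge1$ and $v<0$ let $\phi(t,x)=-2\sqrt{t|x|}$, $$\Psi_v(t,x)=|v|^{-3/4}\chi\!\left(\frac{x-vt}{t^{1/2}|v|^{3/4}}\right)e^{i\phi(t,x)},\qquad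 \gamma(t,v)=\int_{\mathbb R}u(t,x)\overline{\Psi_v(t,x)}\,dx,$$ and for $\alpha>0$ let $\Omega_\alpha(t)=\{v<0:\ t^{-\alpha}\le -v\le t^{\alpha}\}$. **Proposition.** (i) There is a constant $C>0$ depending only on $\chi$ such that, for all $t\ge1$ and all $u$ with $u(t)\in L^\infty(\mathbb R)$, one has $\gamma(t,\cdot)\in L^\infty((-\infty,0))$ and $$\|\gamma(t)\|_{L^\infty_v((-\infty,0))}\le C\,t^{1/2}\|u(t)\|_{L^\infty_x}.$$ (ii) Let $s>\frac52$ and $0<\alpha<\frac2{2s-1}$. There is a constant $C>0$ depending only on $s,\alpha,\chi$ such that, for all $t\ge1$, all $u$ with $u(t)\in L^2$ and $\|u(t)\|_{X^s}<\infty$ ($u(t)$ being identified with its continuous representative, which is then differentiable), and all $v\in\Omega_\alpha(t)$, $$\left|u(t,vt)-2t^{-1/2}\operatorname{Re}\{e^{i\phi(t,vt)}\gamma(t,v)\}\right|\le C\left\{t^{-3/4}|v|^{-5/8}+t^{-\frac{2s-1}{2s+2}}(1+\log t)\right\}\|u(t)\|_{X^s},$$ $$\left|u_x(t,vt)-2t^{-1/2}|v|^{-1/2}\operatorname{Re}\{i\,e^{i\phi(t,vt)}\gamma(t,v)\}\right|\le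 C\left\{t^{-3/4}|v|^{-9/8}+t^{-\frac{2s-3}{2s+2}}(1+\log t)\right\}\|u(t)\|_{X^s}.$$ -/

import Mathlib

open MeasureTheory Set
open scoped ENNReal ContDiff FourierTransform ComplexConjugate

noncomputable section

namespace ShortPulse

/-- The fixed small constant entering the support condition on the wave packet profile. -/
def delta : ℝ := 1 / 1000

/-- The `L²` Fourier transform with the normalisation
`f̂(ξ) = (2π)^{-1/2} ∫ e^{-ixξ} f(x) dx` (set to `0` when `f ∉ L²`). Mathlib's transform `𝓕`, whose
kernel is `e^{-2πixξ}`, is rescaled accordingly. -/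
def fourierL2 (f : ℝ → ℂ) : ℝ → ℂ := fun ξ =>
  open Classical in
  if h : MemLp f 2 (volume : Measure ℝ) then
    (((√(2 * Real.pi))⁻¹ : ℝ) : ℂ) * (𝓕 (h.toLp f) : Lp ℂ 2 (volume : Measure ℝ)) (ξ / (2 * Real.pi))
  else 0

/-- The inverse of `fourierL2`:
`𝓕⁻¹[g](x) = (2π)^{-1/2} ∫ e^{ixξ} g(ξ) dξ` (set to `0` when `g ∉ L²`). -/
def fourierInvL2 (g : ℝ → ℂ) : ℝ → ℂ := fun x =>
  open Classical in
  if h : MemLp g 2 (volume : Measure ℝ) then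
    (((√(2 * Real.pi))⁻¹ : ℝ) : ℂ) * (𝓕⁻ (h.toLp g) : Lp ℂ 2 (volume : Measure ℝ)) (x / (2 * Real.pi))
  else 0

/-- The inhomogeneous Sobolev norm `‖f‖_{H^s} = ‖(1 + ξ²)^{s/2} f̂‖_{L²}` of an `L²` function. -/
def sobolevNorm (s : ℝ) (f : ℝ → ℂ) : ℝ≥0∞ :=
  eLpNorm (fun ξ : ℝ => (((1 + ξ ^ 2) ^ (s / 2) : ℝ) : ℂ) * fourierL2 f ξ) 2 volume

/-- The homogeneous Sobolev norm `‖f‖_{Ḣ^s} = ‖|ξ|^s f̂‖_{L²}` of an `L²` function. -/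
def homSobolevNorm (s : ℝ) (f : ℝ → ℂ) : ℝ≥0∞ :=
  eLpNorm (fun ξ : ℝ => ((|ξ| ^ s : ℝ) : ℂ) * fourierL2 f ξ) 2 volume

/-- `∂ₓ⁻¹ f = 𝓕⁻¹[f̂ / (iξ)]`, for `f ∈ L² ∩ Ḣ⁻¹`. -/
def invDx (f : ℝ → ℂ) : ℝ → ℂ :=
  fourierInvL2 (fun ξ : ℝ => fourierL2 f ξ / (Complex.I * (ξ : ℂ)))

/-- `J ∂ₓ f` for the vector field `J = x - t ∂ₓ⁻²`, that is, `J ∂ₓ f = x ∂ₓ f - t ∂ₓ⁻¹ f`. -/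
def JDx (t : ℝ) (f : ℝ → ℂ) : ℝ → ℂ := fun x =>
  (x : ℂ) * deriv f x - (t : ℂ) * invDx f x

/-- The norm `‖f‖_{X^s} = (‖f‖_{H^s}² + ‖f‖_{Ḣ⁻¹}² + ‖J ∂ₓ f‖_{L²}²)^{1/2}` at time `t`, with value
`∞` allowed, of a real-valued function `f` of the spatial variable. -/
def xNorm (s t : ℝ) (f : ℝ → ℝ) : ℝ≥0∞ :=
  (sobolevNorm s (fun x => (f x : ℂ)) ^ 2 + homSobolevNorm (-1) (fun x => (f x : ℂ)) ^ 2
    + eLpNorm (JDx t (fun x => (f x : ℂ))) 2 volume ^ 2) ^ (1 / 2 : ℝ)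

/-- `f` is an `L²` function whose `X^s` norm at time `t` is finite, represented by its continuous
representative (which exists for `s > 1/2`, by Sobolev embedding). -/
structure MemX (s t : ℝ) (f : ℝ → ℝ) : Prop where
  continuous : Continuous f
  memLp : MemLp f 2 (volume : Measure ℝ)
  xNorm_lt_top : xNorm s t f < ⊤

/-- The phase `φ(t,x) = -2 √(t|x|)`. -/
def phase (t x : ℝ) : ℝ := -2 * √(t * |x|)

/-- The wave packet
`Ψ_v(t,x) = |v|^{-3/4} χ((x - vt) / (t^{1/2} |v|^{3/4})) e^{iφ(t,x)}`. -/
def wavePacket (χ : ℝ → ℂ) (v t x : ℝ) : ℂ :=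
  ((|v| ^ (-(3 / 4) : ℝ) : ℝ) : ℂ)
    * χ ((x - v * t) / (t ^ (1 / 2 : ℝ) * |v| ^ (3 / 4 : ℝ)))
    * Complex.exp (Complex.I * (phase t x : ℂ))

/-- `γ(t,v) = ∫ u(t,x) conj(Ψ_v(t,x)) dx`. -/
def gamma (χ : ℝ → ℂ) (u : ℝ → ℝ → ℝ) (t v : ℝ) : ℂ :=
  ∫ x : ℝ, (u t x : ℂ) * conj (wavePacket χ v t x)

/-- `Ω_α(t) = {v < 0 : t^{-α} ≤ -v ≤ t^α}`. -/
def Omega (α t : ℝ) : Set ℝ := {v | v < 0 ∧ t ^ (-α) ≤ -v ∧ -v ≤ t ^ α}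

end ShortPulse

end

noncomputable section

/-! Write `w = ∂ₓ⁻¹ u`, so that `u = w'`. Finiteness of the `X^s` norm puts `w`, `u`, `u'` and `g =
x u' - t w` in `L²`. On `x < 0` the equation `x w'' - t w + w'/2 = 0` has the exact solutions
`e^{±2ip}` with `p = √(t|x|)`, so variation of constants gives `w` a complex amplitude `B` (the
coefficient of `e^{-2ip} = e^{iφ}`, up to the factor `1/r`) whose derivative only sees the residual
`g + u/2`. Hence `B` is nearly constant on the scale `R = t^{1/2}|v|^{3/4}` of a wave packet.

With `|v| = r²`, one has `u e^{2ip} = i (tr/p)(B - conj B · e^{4ip})`. Testing `u` against the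
packet therefore returns `i B` at the centre `x₀ = vt`, up to the variation of `B` and a
non-resonant term removed by integration by parts (`Profile.norm_packet_sub_amplitude_le`).
Unwinding the definition of `B`, `t^{-1/2} e^{iφ} γ` approximates `(u + i w / r) / 2` at `x₀`
(`exists_packet_approximation`). The real part is the estimate for `u`, with only the first of the
two error terms.

The imaginary part controls `w`, so the estimate for `u_x` needs in addition that `u' + w / |v|` is
small at `x₀`. Near `x₀` this quantity is about `g / x`, which is small in `L²`. To pass to a
pointwise bound, its value at `x₀` is compared with its values at `x₀ - jy` through an `m`-th
difference, averaged over `0 ≤ y ≤ l`. The difference gains `l^{s-3/2}` from `H^s` regularity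
(`exists_difference_bound`), the average costs `l^{-1/2} / (t|v|)`
(`Profile.abs_deriv_add_le_of_difference`), and `l = t^{-1/(s+1)}` makes both acceptable. -/

namespace ShortPulse

/-! ### The `L²` Fourier transform and its realisation as an integral -/

/-- The inverse Fourier integral `(2π)^{-1/2} ∫ e^{ixξ} g(ξ) dξ`. -/
def synth (g : ℝ → ℂ) (x : ℝ) : ℂ :=
  (((√(2 * Real.pi))⁻¹ : ℝ) : ℂ) * ∫ ξ : ℝ, Complex.exp (Complex.I * ((x * ξ : ℝ) : ℂ)) * g ξ

lemma two_pi_inv_pos : 0 < (2 * Real.pi)⁻¹ := by positivity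

lemma map_div_two_pi :
    Measure.map (fun x : ℝ => x / (2 * Real.pi)) volume
      = ENNReal.ofReal (2 * Real.pi) • (volume : Measure ℝ) := by
  have h := Real.map_volume_mul_right (a := (2 * Real.pi)⁻¹) two_pi_inv_pos.ne'
  rw [inv_inv, abs_of_pos (by positivity : 0 < 2 * Real.pi)] at h
  simpa [div_eq_mul_inv] using h

lemma quasiMeasurePreserving_div_two_pi :
    Measure.QuasiMeasurePreserving (fun x : ℝ => x / (2 * Real.pi)) volume volume := by
  refine ⟨by fun_prop, ?_⟩
  rw [map_div_two_pi]
  exact Measure.smul_absolutelyContinuous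

/-- The Jacobian `2π` of the dilation cancels the square of the prefactor `(2π)^{-1/2}`, so
Plancherel carries over to the present normalisation. -/
lemma eLpNorm_rescale {f : ℝ → ℂ} (hf : AEStronglyMeasurable f volume) :
    eLpNorm (fun x : ℝ => (((√(2 * Real.pi))⁻¹ : ℝ) : ℂ) * f (x / (2 * Real.pi))) 2 volume
      = eLpNorm f 2 volume := by
  have h1 : (fun x : ℝ => (((√(2 * Real.pi))⁻¹ : ℝ) : ℂ) * f (x / (2 * Real.pi)))
      = (((√(2 * Real.pi))⁻¹ : ℝ) : ℂ) • (f ∘ fun x : ℝ => x / (2 * Real.pi)) := by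
    ext x; simp
  have hpi : (0 : ℝ) < 2 * Real.pi := by positivity
  rw [h1, eLpNorm_const_smul, ← eLpNorm_map_measure, map_div_two_pi, eLpNorm_smul_measure_of_ne_top]
  · rw [smul_eq_mul, ← mul_assoc]
    convert one_mul _
    rw [← ofReal_norm, Complex.norm_real, ENNReal.ofReal_rpow_of_pos hpi,
      ← ENNReal.ofReal_mul (norm_nonneg _), ← ENNReal.ofReal_one]
    congr 1
    rw [Real.norm_of_nonneg (by positivity), Real.sqrt_eq_rpow]
    norm_num
    exact inv_mul_cancel₀ (by positivity)
  · norm_num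
  · rw [map_div_two_pi]; exact hf.smul_measure _
  · fun_prop

lemma eLpNorm_fourierL2 {f : ℝ → ℂ} (hf : MemLp f 2 volume) :
    eLpNorm (fourierL2 f) 2 volume = eLpNorm f 2 volume := by
  have : fourierL2 f = fun ξ : ℝ => (((√(2 * Real.pi))⁻¹ : ℝ) : ℂ) *
      (𝓕 (hf.toLp f) : Lp ℂ 2 (volume : Measure ℝ)) (ξ / (2 * Real.pi)) := by
    ext ξ; simp [fourierL2, hf]
  rw [this, eLpNorm_rescale (Lp.aestronglyMeasurable _), ← Lp.enorm_def, ← eLpNorm_congr_ae hf.coeFn_toLp,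
    ← Lp.enorm_def, ← ofReal_norm, ← ofReal_norm, Lp.norm_fourier_eq]

lemma eLpNorm_fourierInvL2 {f : ℝ → ℂ} (hf : MemLp f 2 volume) :
    eLpNorm (fourierInvL2 f) 2 volume = eLpNorm f 2 volume := by
  have : fourierInvL2 f = fun ξ : ℝ => (((√(2 * Real.pi))⁻¹ : ℝ) : ℂ) *
      (𝓕⁻ (hf.toLp f) : Lp ℂ 2 (volume : Measure ℝ)) (ξ / (2 * Real.pi)) := by
    ext ξ; simp [fourierInvL2, hf]
  rw [this, eLpNorm_rescale (Lp.aestronglyMeasurable _), ← Lp.enorm_def, ← eLpNorm_congr_ae hf.coeFn_toLp,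
    ← Lp.enorm_def, ← ofReal_norm, ← ofReal_norm, ← Lp.norm_fourier_eq (𝓕⁻ _),
    FourierTransform.fourier_fourierInv_eq]

lemma aestronglyMeasurable_fourierL2 (f : ℝ → ℂ) : AEStronglyMeasurable (fourierL2 f) volume := by
  by_cases hf : MemLp f 2 volume
  · have : fourierL2 f = fun ξ : ℝ => (((√(2 * Real.pi))⁻¹ : ℝ) : ℂ) *
        (𝓕 (hf.toLp f) : Lp ℂ 2 (volume : Measure ℝ)) (ξ / (2 * Real.pi)) := by
      ext ξ; simp [fourierL2, hf]
    rw [this]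
    exact ((Lp.aestronglyMeasurable _).comp_quasiMeasurePreserving
      quasiMeasurePreserving_div_two_pi).const_mul _
  · have : fourierL2 f = fun _ => 0 := by ext ξ; simp [fourierL2, hf]
    rw [this]; exact aestronglyMeasurable_const

/-- The `L²` inverse Fourier transform is given by the Fourier integral on `L¹ ∩ L²`. -/
lemma coe_fourierInv_toLp_ae_eq {f : ℝ → ℂ} (h1 : Integrable f volume) (h2 : MemLp f 2 volume) :
    (𝓕⁻ (h2.toLp f) : Lp ℂ 2 (volume : Measure ℝ)) =ᵐ[volume] (𝓕⁻ f : ℝ → ℂ) := by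
  have hcont : Continuous (𝓕⁻ f : ℝ → ℂ) :=
    VectorFourier.fourierIntegral_continuous (L := -innerₗ ℝ) Real.continuous_fourierChar
      (by simp only [LinearMap.neg_apply, innerₗ_apply_apply]; fun_prop) h1
  refine ae_eq_of_integral_contDiff_smul_eq
    ((Lp.memLp _).locallyIntegrable (by norm_num)) hcont.locallyIntegrable ?_
  intro g g_smooth g_cpt
  have hg₁ : HasCompactSupport (Complex.ofRealCLM ∘ g) := g_cpt.comp_left rfl
  have hg₂ : ContDiff ℝ ∞ (Complex.ofRealCLM ∘ g) := by fun_prop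
  set G := hg₁.toSchwartzMap hg₂ with hG
  have hGx : ∀ x, G x = (g x : ℂ) := fun x => by simp [hG]
  have e := congrArg (fun T => T G) (Lp.fourierInv_toTemperedDistribution_eq (h2.toLp f))
  simp only [TemperedDistribution.fourierInv_apply, Lp.toTemperedDistribution_apply] at e
  -- Fubini moves the Fourier integral from the test function to `f`; the distributional identity
  -- `e` does the same for the `L²` transform.
  have e2 : ∫ x, (VectorFourier.fourierIntegral Real.fourierChar volume (-innerₗ ℝ) G x) • f x
      = ∫ x, G x • (VectorFourier.fourierIntegral Real.fourierChar volume (-innerₗ ℝ).flip f x) :=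
    VectorFourier.integral_fourierIntegral_smul_eq_flip Real.continuous_fourierChar
      (by simp only [LinearMap.neg_apply, innerₗ_apply_apply]; fun_prop) G.integrable h1
  have hflip : (-innerₗ ℝ : ℝ →ₗ[ℝ] ℝ →ₗ[ℝ] ℝ).flip = -innerₗ ℝ := by
    ext; simp
  rw [hflip] at e2
  calc ∫ x, g x • (𝓕⁻ (h2.toLp f) : Lp ℂ 2 (volume : Measure ℝ)) x
      = ∫ x, G x • (𝓕⁻ (h2.toLp f) : Lp ℂ 2 (volume : Measure ℝ)) x := by simp [hGx]
    _ = ∫ x, (𝓕⁻ G) x • (h2.toLp f) x := e.symm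
    _ = ∫ x, (𝓕⁻ (G : ℝ → ℂ)) x • f x := by
        refine integral_congr_ae ?_
        filter_upwards [h2.coeFn_toLp] with x hx
        rw [hx, SchwartzMap.fourierInv_coe]
    _ = ∫ x, G x • (𝓕⁻ f : ℝ → ℂ) x := e2
    _ = _ := by simp [hGx]

lemma fourierInv_div_two_pi (f : ℝ → ℂ) (x : ℝ) :
    (((√(2 * Real.pi))⁻¹ : ℝ) : ℂ) * (𝓕⁻ f : ℝ → ℂ) (x / (2 * Real.pi)) = synth f x := by
  rw [Real.fourierInv_eq', synth]
  congr 2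
  ext ξ
  rw [smul_eq_mul]
  congr 2
  have : (Real.pi : ℂ) ≠ 0 := by exact_mod_cast Real.pi_ne_zero
  simp
  field_simp

lemma fourierInvL2_ae_eq_synth {f : ℝ → ℂ} (h1 : Integrable f volume) (h2 : MemLp f 2 volume) :
    fourierInvL2 f =ᵐ[volume] synth f := by
  filter_upwards [quasiMeasurePreserving_div_two_pi.ae (coe_fourierInv_toLp_ae_eq h1 h2)] with x hx
  rw [← fourierInv_div_two_pi, ← hx]
  simp [fourierInvL2, h2]

lemma eLpNorm_synth {f : ℝ → ℂ} (h1 : Integrable f volume) (h2 : MemLp f 2 volume) :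
    eLpNorm (synth f) 2 volume = eLpNorm f 2 volume := by
  rw [← eLpNorm_congr_ae (fourierInvL2_ae_eq_synth h1 h2), eLpNorm_fourierInvL2 h2]

/-- Fourier inversion for `L²` functions with integrable transform. -/
lemma ae_eq_synth_fourierL2 {f : ℝ → ℂ} (hf : MemLp f 2 volume)
    (h1 : Integrable (fourierL2 f) volume) : f =ᵐ[volume] synth (fourierL2 f) := by
  set F : Lp ℂ 2 (volume : Measure ℝ) := 𝓕 (hf.toLp f) with hF
  have hpi : (2 * Real.pi : ℝ) ≠ 0 := by positivity
  have hfF : ∀ ξ, fourierL2 f ξ = (((√(2 * Real.pi))⁻¹ : ℝ) : ℂ) * F (ξ / (2 * Real.pi)) := by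
    intro ξ; simp [fourierL2, hf, hF]
  have hc : ((√(2 * Real.pi) : ℝ) : ℂ) * (((√(2 * Real.pi))⁻¹ : ℝ) : ℂ) = 1 := by
    rw [← Complex.ofReal_mul, mul_inv_cancel₀ (by positivity)]; simp
  have hFf : ∀ ζ, F ζ = ((√(2 * Real.pi) : ℝ) : ℂ) * fourierL2 f (ζ * (2 * Real.pi)) := by
    intro ζ
    rw [hfF, ← mul_assoc, hc, mul_div_cancel_right₀ _ hpi, one_mul]
  have hFint : Integrable F volume := by
    have : (F : ℝ → ℂ) = fun ζ => ((√(2 * Real.pi) : ℝ) : ℂ) * fourierL2 f (ζ * (2 * Real.pi)) :=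
      funext hFf
    rw [this]
    exact (h1.comp_mul_right' hpi).const_mul _
  have hae := coe_fourierInv_toLp_ae_eq hFint (Lp.memLp F)
  rw [Lp.toLp_coeFn, hF, FourierTransform.fourierInv_fourier_eq] at hae
  filter_upwards [hae, hf.coeFn_toLp] with x hx hx'
  rw [← hx', hx, ← hF, Real.fourierInv_eq', synth]
  have : ∀ ζ : ℝ, Complex.exp (((2 * Real.pi * inner ℝ ζ x : ℝ) : ℂ) * Complex.I) • F ζ
      = (fun ξ : ℝ => ((√(2 * Real.pi) : ℝ) : ℂ) *
        (Complex.exp (Complex.I * ((x * ξ : ℝ) : ℂ)) * fourierL2 f ξ)) (ζ * (2 * Real.pi)) := by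
    intro ζ
    rw [hFf, smul_eq_mul]
    simp only [RCLike.inner_apply, conj_trivial]
    push_cast
    ring_nf
  rw [integral_congr_ae (Filter.Eventually.of_forall this), Measure.integral_comp_mul_right
    (fun ξ : ℝ => ((√(2 * Real.pi) : ℝ) : ℂ) *
        (Complex.exp (Complex.I * ((x * ξ : ℝ) : ℂ)) * fourierL2 f ξ)), integral_const_mul]
  rw [Complex.real_smul, ← mul_assoc]
  congr 1
  rw [← Complex.ofReal_mul]
  congr 1
  rw [abs_of_pos two_pi_inv_pos]
  have := Real.mul_self_sqrt (show 0 ≤ 2 * Real.pi by positivity)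
  have h0 : √(2 * Real.pi) ≠ 0 := by positivity
  field_simp
  nlinarith

/-! ### Bounds, derivatives and differences of Fourier integrals -/

lemma norm_cexp_I_mul_ofReal (x : ℝ) : ‖Complex.exp (Complex.I * (x : ℂ))‖ = 1 := by
  rw [mul_comm]; exact Complex.norm_exp_ofReal_mul_I x

lemma norm_synth_le (g : ℝ → ℂ) (x : ℝ) : ‖synth g x‖ ≤ ∫ ξ : ℝ, ‖g ξ‖ := by
  have h1 : ‖(((√(2 * Real.pi))⁻¹ : ℝ) : ℂ)‖ ≤ 1 := by
    rw [Complex.norm_real, Real.norm_of_nonneg (by positivity)]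
    refine inv_le_one_of_one_le₀ (Real.one_le_sqrt.2 ?_)
    linarith [Real.pi_gt_three]
  have h2 : ‖∫ ξ : ℝ, Complex.exp (Complex.I * ((x * ξ : ℝ) : ℂ)) * g ξ‖ ≤ ∫ ξ : ℝ, ‖g ξ‖ := by
    refine (norm_integral_le_integral_norm _).trans_eq ?_
    simp_rw [norm_mul, norm_cexp_I_mul_ofReal, one_mul]
  rw [synth, norm_mul]
  exact (mul_le_of_le_one_left (norm_nonneg _) h1).trans h2

lemma integrable_cexp_mul {g : ℝ → ℂ} (hg : Integrable g volume) (x : ℝ) :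
    Integrable (fun ξ : ℝ => Complex.exp (Complex.I * ((x * ξ : ℝ) : ℂ)) * g ξ) volume := by
  refine hg.mono ?_ ?_
  · exact (Continuous.aestronglyMeasurable (by fun_prop)).mul hg.aestronglyMeasurable
  · filter_upwards with ξ
    rw [norm_mul, norm_cexp_I_mul_ofReal, one_mul]

lemma hasDerivAt_synth {g : ℝ → ℂ} (hg : Integrable g volume)
    (hg' : Integrable (fun ξ : ℝ => Complex.I * ξ * g ξ) volume) (x : ℝ) :
    HasDerivAt (synth g) (synth (fun ξ : ℝ => Complex.I * ξ * g ξ) x) x := by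
  unfold synth
  refine HasDerivAt.const_mul _ ?_
  refine (hasDerivAt_integral_of_dominated_loc_of_deriv_le (s := univ)
    (F' := fun y ξ => Complex.exp (Complex.I * ((y * ξ : ℝ) : ℂ)) * (Complex.I * ξ * g ξ))
    (bound := fun ξ => ‖Complex.I * ξ * g ξ‖) Filter.univ_mem ?_ (integrable_cexp_mul hg x)
    (integrable_cexp_mul hg' x).aestronglyMeasurable ?_ hg'.norm ?_).2
  · exact Filter.Eventually.of_forall fun y => (integrable_cexp_mul hg y).aestronglyMeasurable
  · refine Filter.Eventually.of_forall fun ξ y _ => ?_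
    rw [norm_mul, norm_cexp_I_mul_ofReal, one_mul]
  · refine Filter.Eventually.of_forall fun ξ y _ => ?_
    have h1 : HasDerivAt (fun y : ℝ => Complex.I * ((y * ξ : ℝ) : ℂ)) (Complex.I * ξ) y := by
      have := ((hasDerivAt_id y).mul_const ξ).ofReal_comp.const_mul Complex.I
      simpa using this
    have := h1.cexp.mul_const (g ξ)
    rw [← mul_assoc]
    exact this

lemma continuous_synth {g : ℝ → ℂ} (hg : Integrable g volume) : Continuous (synth g) := by
  unfold synth
  refine continuous_const.mul ?_
  refine continuous_of_dominated (bound := fun ξ => ‖g ξ‖)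
    (fun y => (integrable_cexp_mul hg y).aestronglyMeasurable) (fun y => ?_) hg.norm ?_
  · refine Filter.Eventually.of_forall fun ξ => ?_
    rw [norm_mul, norm_cexp_I_mul_ofReal, one_mul]
  · refine Filter.Eventually.of_forall fun ξ => ?_
    fun_prop

lemma synth_add_const_mul {g h : ℝ → ℂ} (hg : Integrable g volume) (hh : Integrable h volume)
    (c : ℂ) (x : ℝ) : synth (fun ξ => g ξ + c * h ξ) x = synth g x + c * synth h x := by
  simp only [synth, mul_add]
  rw [integral_add (integrable_cexp_mul hg x)]
  · have : ∀ ξ : ℝ, Complex.exp (Complex.I * ((x * ξ : ℝ) : ℂ)) * (c * h ξ)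
        = c * (Complex.exp (Complex.I * ((x * ξ : ℝ) : ℂ)) * h ξ) := fun ξ => by ring
    simp_rw [this, integral_const_mul]
    ring
  · exact integrable_cexp_mul (hh.const_mul c) x

/-- The `m`-th order backward difference of a Fourier integral. -/
lemma sum_choose_synth {g : ℝ → ℂ} (hg : Integrable g volume) (m : ℕ) (x y : ℝ) :
    ∑ j ∈ Finset.range (m + 1), (((-1) ^ j * (m.choose j : ℝ) : ℝ) : ℂ) * synth g (x - j * y)
      = synth (fun ξ : ℝ => (1 - Complex.exp (Complex.I * ((-(y * ξ) : ℝ) : ℂ))) ^ m * g ξ) x := by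
  simp only [synth]
  have : ∀ j : ℕ, (((-1) ^ j * (m.choose j : ℝ) : ℝ) : ℂ) * ((((√(2 * Real.pi))⁻¹ : ℝ) : ℂ)
      * ∫ ξ : ℝ, Complex.exp (Complex.I * (((x - j * y) * ξ : ℝ) : ℂ)) * g ξ)
      = (((√(2 * Real.pi))⁻¹ : ℝ) : ℂ) * ∫ ξ : ℝ, (((-1) ^ j * (m.choose j : ℝ) : ℝ) : ℂ) *
        (Complex.exp (Complex.I * (((x - j * y) * ξ : ℝ) : ℂ)) * g ξ) := by
    intro j
    rw [integral_const_mul]; ring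
  simp_rw [this]
  rw [← Finset.mul_sum, ← integral_finsetSum]
  · congr 2
    ext ξ
    rw [sub_eq_neg_add, add_pow, Finset.sum_mul, Finset.mul_sum]
    refine Finset.sum_congr rfl fun j _ => ?_
    rw [neg_pow (Complex.exp _), ← Complex.exp_nat_mul, one_pow]
    have : Complex.exp (Complex.I * (((x - j * y) * ξ : ℝ) : ℂ))
        = Complex.exp (Complex.I * ((x * ξ : ℝ) : ℂ))
          * Complex.exp (j * (Complex.I * ((-(y * ξ) : ℝ) : ℂ))) := by
      rw [← Complex.exp_add]; congr 1; push_cast; ring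
    rw [this]
    push_cast
    ring
  · intro j _
    exact (integrable_cexp_mul hg _).const_mul _

/-! ### Cauchy–Schwarz and integrability on the Fourier side -/

lemma toReal_eLpNorm_two {f : ℝ → ℂ} {μ : Measure ℝ} (hf : MemLp f 2 μ) :
    (eLpNorm f 2 μ).toReal = √(∫ x, ‖f x‖ ^ 2 ∂μ) := by
  rw [hf.eLpNorm_eq_integral_rpow_norm (by norm_num) (by norm_num), ENNReal.toReal_ofReal,
    Real.sqrt_eq_rpow]
  · norm_num
  · exact Real.rpow_nonneg (integral_nonneg fun _ => by positivity) _

/-- The Cauchy–Schwarz inequality. -/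
lemma integral_norm_mul_norm_le {f g : ℝ → ℂ} {μ : Measure ℝ} (hf : MemLp f 2 μ)
    (hg : MemLp g 2 μ) :
    ∫ x, ‖f x‖ * ‖g x‖ ∂μ ≤ (eLpNorm f 2 μ).toReal * (eLpNorm g 2 μ).toReal := by
  have h := integral_mul_norm_le_Lp_mul_Lq (μ := μ) (f := f) (g := g) (p := 2) (q := 2)
    (Real.HolderConjugate.two_two) (by simpa using hf) (by simpa using hg)
  rw [toReal_eLpNorm_two hf, toReal_eLpNorm_two hg, Real.sqrt_eq_rpow, Real.sqrt_eq_rpow]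
  simpa using h

lemma memLp_inv_sqrt_one_add_sq :
    MemLp (fun ξ : ℝ => (((1 + ξ ^ 2) ^ (-(1 / 2) : ℝ) : ℝ) : ℂ)) 2 volume := by
  have hpos : ∀ ξ : ℝ, 0 < 1 + ξ ^ 2 := fun ξ => by positivity
  rw [memLp_two_iff_integrable_sq_norm]
  · refine integrable_inv_one_add_sq.congr (Filter.Eventually.of_forall fun ξ => ?_)
    beta_reduce
    rw [Complex.norm_real, Real.norm_of_nonneg (Real.rpow_nonneg (hpos ξ).le _),
      ← Real.rpow_natCast ((1 + ξ ^ 2) ^ (-(1 / 2) : ℝ)), ← Real.rpow_mul (hpos ξ).le]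
    norm_num [Real.rpow_neg_one]
  · refine Continuous.aestronglyMeasurable ?_
    exact Complex.continuous_ofReal.comp
      (Continuous.rpow_const (by fun_prop) fun ξ => Or.inl (hpos ξ).ne')

/-- An `L²` function times `(1 + ξ²)^{-1/2}` is integrable. -/
lemma integrable_of_norm_le {f h : ℝ → ℂ} (hf : MemLp f 2 volume)
    (hh : AEStronglyMeasurable h volume)
    (hb : ∀ ξ, ‖h ξ‖ ≤ (1 + ξ ^ 2) ^ (-(1 / 2) : ℝ) * ‖f ξ‖) : Integrable h volume := by
  refine (memLp_inv_sqrt_one_add_sq.integrable_mul hf).mono hh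
    (Filter.Eventually.of_forall fun ξ => ?_)
  rw [Pi.mul_apply, norm_mul, Complex.norm_real,
    Real.norm_of_nonneg (Real.rpow_nonneg (by positivity) _)]
  exact hb ξ

/-- The weighted transform controlling `H^s`. -/
def sobolevWeighted (s : ℝ) (ψ : ℝ → ℂ) (ξ : ℝ) : ℂ := (((1 + ξ ^ 2) ^ (s / 2) : ℝ) : ℂ) * ψ ξ

lemma norm_sobolevWeighted (s : ℝ) (ψ : ℝ → ℂ) (ξ : ℝ) :
    ‖sobolevWeighted s ψ ξ‖ = (1 + ξ ^ 2) ^ (s / 2) * ‖ψ ξ‖ := by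
  rw [sobolevWeighted, norm_mul, Complex.norm_real,
    Real.norm_of_nonneg (Real.rpow_nonneg (by positivity) _)]

lemma norm_le_norm_sobolevWeighted {s : ℝ} (hs : 0 ≤ s) (ψ : ℝ → ℂ) (ξ : ℝ) :
    ‖ψ ξ‖ ≤ ‖sobolevWeighted s ψ ξ‖ := by
  rw [norm_sobolevWeighted]
  exact le_mul_of_one_le_left (norm_nonneg _)
    (Real.one_le_rpow (by nlinarith [sq_nonneg ξ]) (by positivity))

lemma abs_le_sqrt_one_add_sq (ξ : ℝ) : |ξ| ≤ (1 + ξ ^ 2) ^ (1 / 2 : ℝ) := by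
  rw [← Real.sqrt_eq_rpow]
  exact Real.abs_le_sqrt (by linarith)

lemma one_le_sqrt_one_add_sq (ξ : ℝ) : 1 ≤ (1 + ξ ^ 2) ^ (1 / 2 : ℝ) :=
  Real.one_le_rpow (by nlinarith [sq_nonneg ξ]) (by norm_num)

lemma rpow_half_split {s : ℝ} (hs : 2 ≤ s) (ξ : ℝ) :
    (1 + ξ ^ 2) ^ (1 / 2 : ℝ) ≤ (1 + ξ ^ 2) ^ (-(1 / 2) : ℝ) * (1 + ξ ^ 2) ^ (s / 2) := by
  rw [← Real.rpow_add (by positivity)]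
  exact Real.rpow_le_rpow_of_exponent_le (by nlinarith [sq_nonneg ξ]) (by linarith)

section

variable {s : ℝ} {ψ : ℝ → ℂ}

lemma integrable_of_sobolev (hs : 2 ≤ s) (hψ : AEStronglyMeasurable ψ volume)
    (hP : MemLp (sobolevWeighted s ψ) 2 volume) : Integrable ψ volume := by
  refine integrable_of_norm_le hP hψ fun ξ => ?_
  rw [norm_sobolevWeighted, ← mul_assoc]
  exact le_mul_of_one_le_left (norm_nonneg _)
    ((one_le_sqrt_one_add_sq ξ).trans (rpow_half_split hs ξ))

lemma norm_I_mul_mul (ψ : ℝ → ℂ) (ξ : ℝ) : ‖Complex.I * ξ * ψ ξ‖ = |ξ| * ‖ψ ξ‖ := by simp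

lemma norm_div_I_mul (ψ : ℝ → ℂ) (ξ : ℝ) : ‖ψ ξ / (Complex.I * ξ)‖ = |ξ|⁻¹ * ‖ψ ξ‖ := by
  simp [div_eq_inv_mul]

lemma integrable_mul_of_sobolev (hs : 2 ≤ s) (hψ : AEStronglyMeasurable ψ volume)
    (hP : MemLp (sobolevWeighted s ψ) 2 volume) :
    Integrable (fun ξ : ℝ => Complex.I * ξ * ψ ξ) volume := by
  refine integrable_of_norm_le hP
    ((Continuous.aestronglyMeasurable (by fun_prop)).mul hψ) fun ξ => ?_
  rw [norm_sobolevWeighted, ← mul_assoc, norm_I_mul_mul]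
  gcongr
  exact (abs_le_sqrt_one_add_sq ξ).trans (rpow_half_split hs ξ)

lemma norm_I_mul_mul_le (hs : 1 ≤ s) (ψ : ℝ → ℂ) (ξ : ℝ) :
    ‖Complex.I * ξ * ψ ξ‖ ≤ ‖sobolevWeighted s ψ ξ‖ := by
  rw [norm_sobolevWeighted, norm_I_mul_mul]
  gcongr
  refine (abs_le_sqrt_one_add_sq ξ).trans ?_
  exact Real.rpow_le_rpow_of_exponent_le (by nlinarith [sq_nonneg ξ]) (by linarith)

lemma memLp_mul_of_sobolev (hs : 1 ≤ s) (hψ : AEStronglyMeasurable ψ volume)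
    (hP : MemLp (sobolevWeighted s ψ) 2 volume) :
    MemLp (fun ξ : ℝ => Complex.I * ξ * ψ ξ) 2 volume :=
  hP.mono ((Continuous.aestronglyMeasurable (by fun_prop)).mul hψ)
    (Filter.Eventually.of_forall fun ξ => norm_I_mul_mul_le hs ψ ξ)

lemma aestronglyMeasurable_div_I_mul (hψ : AEStronglyMeasurable ψ volume) :
    AEStronglyMeasurable (fun ξ : ℝ => ψ ξ / (Complex.I * ξ)) volume := by
  refine (hψ.aemeasurable.div ?_).aestronglyMeasurable
  exact Measurable.aemeasurable (by fun_prop)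

/-- The singularity at `ξ = 0` is absorbed by the `Ḣ⁻¹` part, while for `|ξ| ≥ 1` dividing by `ξ`
only helps and the Sobolev weight gives decay. -/
lemma integrable_div_of_sobolev (hs : 2 ≤ s) (hψ : AEStronglyMeasurable ψ volume)
    (hP : MemLp (sobolevWeighted s ψ) 2 volume)
    (hQ : MemLp (fun ξ : ℝ => ψ ξ / (Complex.I * ξ)) 2 volume) :
    Integrable (fun ξ : ℝ => ψ ξ / (Complex.I * ξ)) volume := by
  have hf : MemLp (fun ξ : ℝ => ((‖sobolevWeighted s ψ ξ‖ +
      2 * ‖ψ ξ / (Complex.I * ξ)‖ : ℝ) : ℂ)) 2 volume :=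
    (hP.norm.add (hQ.norm.const_mul 2)).ofReal
  refine integrable_of_norm_le hf (aestronglyMeasurable_div_I_mul hψ) fun ξ => ?_
  rw [Complex.norm_real, Real.norm_of_nonneg (by positivity), mul_add]
  have h0 : 0 ≤ (1 + ξ ^ 2) ^ (-(1 / 2) : ℝ) := Real.rpow_nonneg (by positivity) _
  rcases le_total |ξ| 1 with h | h
  -- For `|ξ| ≤ 1` the weight is at least `1/√2`; the factor `2` in the majorant compensates for the
  -- cruder bound `1/2`.
  · have h1 : 1 / 2 ≤ (1 + ξ ^ 2) ^ (-(1 / 2) : ℝ) := by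
      rw [Real.rpow_neg (by positivity), ← Real.sqrt_eq_rpow, one_div]
      have hξ : ξ ^ 2 ≤ 1 := by rw [← sq_abs]; nlinarith [abs_nonneg ξ]
      refine inv_anti₀ (Real.sqrt_pos.2 (by positivity)) ?_
      rw [Real.sqrt_le_left (by norm_num)]
      linarith
    nlinarith [norm_nonneg (ψ ξ / (Complex.I * ξ)), mul_nonneg h0
      (norm_nonneg (sobolevWeighted s ψ ξ))]
  · have h1 : ‖ψ ξ / (Complex.I * ξ)‖ ≤ ‖ψ ξ‖ := by
      rw [norm_div_I_mul]
      exact mul_le_of_le_one_left (norm_nonneg _) (inv_le_one_of_one_le₀ h)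
    have h2 : ‖ψ ξ‖ ≤ (1 + ξ ^ 2) ^ (-(1 / 2) : ℝ) * ‖sobolevWeighted s ψ ξ‖ := by
      rw [norm_sobolevWeighted, ← mul_assoc]
      exact le_mul_of_one_le_left (norm_nonneg _)
        ((one_le_sqrt_one_add_sq ξ).trans (rpow_half_split hs ξ))
    have : 0 ≤ (1 + ξ ^ 2) ^ (-(1 / 2) : ℝ) * (2 * ‖ψ ξ / (Complex.I * ξ)‖) := by positivity
    linarith

/-! ### Regularity of `u' + w / a` measured by differences -/

/-- The multiplier of the `m`-th difference is dominated by a rescaled integrable weight. -/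
lemma difference_multiplier_le (hs : 1 ≤ s) {m : ℕ} (hm : s + 1 ≤ m) {a l y : ℝ} (hl : 0 < l)
    (hla : l ^ 2 ≤ a) (hy : 0 ≤ y) (hyl : y ≤ l) (ξ : ℝ) :
    ‖(1 - Complex.exp (Complex.I * ((-(y * ξ) : ℝ) : ℂ))) ^ m‖ * (|ξ| + a⁻¹ * |ξ|⁻¹)
        * (1 + ξ ^ 2) ^ (-(s / 2))
      ≤ 2 ^ (m + s) * l ^ (s - 1) * (1 + |l * ξ|) ^ (-(s - 1)) := by
  have ha : 0 < a := (by positivity : 0 < l ^ 2).trans_le hla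
  set E := ‖1 - Complex.exp (Complex.I * ((-(y * ξ) : ℝ) : ℂ))‖ with hE
  have hE2 : E ≤ 2 := by
    refine (norm_sub_le _ _).trans ?_
    rw [norm_cexp_I_mul_ofReal]; norm_num
  have hEl : E ≤ |l * ξ| := by
    rw [hE, norm_sub_rev]
    refine (Real.norm_exp_I_mul_ofReal_sub_one_le).trans ?_
    rw [Real.norm_eq_abs, abs_neg, abs_mul, abs_mul, abs_of_nonneg hy, abs_of_pos hl]
    gcongr
  rw [norm_pow]
  -- At the origin the convention `0⁻¹ = 0` makes the left side vanish.
  rcases eq_or_ne ξ 0 with rfl | hξ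
  · simp only [abs_zero, inv_zero, mul_zero, add_zero, zero_mul]
    positivity
  have hx : 0 < |ξ| := abs_pos.2 hξ
  have hη : |l * ξ| = l * |ξ| := by rw [abs_mul, abs_of_pos hl]
  set η := |l * ξ| with hη'
  have hη0 : 0 < η := by rw [hη]; positivity
  have hxη : |ξ| = η / l := by rw [hη]; field_simp
  -- The condition `l² ≤ a` is what makes the `|ξ|⁻¹` term scale like the `|ξ|` term in the variable
  -- `η = l|ξ|`.
  have h1 : |ξ| + a⁻¹ * |ξ|⁻¹ ≤ l⁻¹ * (η + η⁻¹) := by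
    have : a⁻¹ ≤ (l ^ 2)⁻¹ := inv_anti₀ (by positivity) hla
    calc |ξ| + a⁻¹ * |ξ|⁻¹ ≤ |ξ| + (l ^ 2)⁻¹ * |ξ|⁻¹ := by gcongr
      _ = l⁻¹ * (η + η⁻¹) := by rw [hxη]; field_simp
  have h2 : (1 + ξ ^ 2) ^ (-(s / 2)) ≤ l ^ s * η ^ (-s) := by
    calc (1 + ξ ^ 2) ^ (-(s / 2)) ≤ (ξ ^ 2) ^ (-(s / 2)) :=
          Real.rpow_le_rpow_of_nonpos (by positivity) (by linarith) (by linarith)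
      _ = |ξ| ^ (-s) := by
          rw [← sq_abs, ← Real.rpow_natCast, ← Real.rpow_mul hx.le]; congr 1; push_cast; ring
      _ = l ^ s * η ^ (-s) := by
          rw [hxη, Real.div_rpow hη0.le hl.le, Real.rpow_neg hl.le]; field_simp
  have h3 : E ^ m * (η + η⁻¹) * η ^ (-s) ≤ 2 ^ (m + s) * (1 + η) ^ (-(s - 1)) := by
    have hE0 : 0 ≤ E := norm_nonneg _
    rcases le_total η 1 with h | h
    -- At low frequency the order `m ≥ s + 1` of vanishing cancels the factors `η⁻¹` and `η^{-s}`.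
    -- For `η ≥ 1` the trivial bound `E ≤ 2` suffices.
    · have e1 : E ^ m ≤ η ^ (s + 1) := by
        calc E ^ m ≤ η ^ m := by gcongr
          _ = η ^ (m : ℝ) := (Real.rpow_natCast _ _).symm
          _ ≤ η ^ (s + 1) := Real.rpow_le_rpow_of_exponent_ge hη0 h hm
      have e2 : η + η⁻¹ ≤ 2 * η⁻¹ := by
        have : 1 ≤ η⁻¹ := (one_le_inv₀ hη0).2 h
        linarith
      have e3 : 2 ^ (-(s - 1)) ≤ (1 + η) ^ (-(s - 1)) :=
        Real.rpow_le_rpow_of_nonpos (by positivity) (by linarith) (by linarith)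
      calc E ^ m * (η + η⁻¹) * η ^ (-s) ≤ η ^ (s + 1) * (2 * η⁻¹) * η ^ (-s) := by gcongr
        _ = 2 := by
            rw [Real.rpow_add hη0, Real.rpow_one, Real.rpow_neg hη0.le]
            have := (Real.rpow_pos_of_pos hη0 s).ne'
            field_simp
        _ = 2 ^ s * 2 ^ (-(s - 1)) := by
            rw [← Real.rpow_add (by norm_num)]; norm_num
        _ ≤ 2 ^ (m + s) * (1 + η) ^ (-(s - 1)) := by
            gcongr
            · norm_num
            · linarith [show (0 : ℝ) ≤ m by positivity]
    · have e1 : E ^ m ≤ 2 ^ (m : ℝ) := by rw [Real.rpow_natCast]; gcongr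
      have e2 : η + η⁻¹ ≤ 2 * η := by
        have : η⁻¹ ≤ 1 := inv_le_one_of_one_le₀ h
        linarith
      have e3 : η ^ (-(s - 1)) ≤ 2 ^ (s - 1) * (1 + η) ^ (-(s - 1)) := by
        have h4 : (1 + η) ^ (s - 1) ≤ (2 * η) ^ (s - 1) :=
          Real.rpow_le_rpow (by positivity) (by linarith) (by linarith)
        rw [Real.mul_rpow (by norm_num) hη0.le] at h4
        rw [Real.rpow_neg hη0.le, Real.rpow_neg (by positivity), ← div_eq_mul_inv,
          le_div_iff₀ (by positivity), inv_mul_le_iff₀ (by positivity)]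
        linarith
      calc E ^ m * (η + η⁻¹) * η ^ (-s) ≤ 2 ^ (m : ℝ) * (2 * η) * η ^ (-s) := by gcongr
        _ = 2 ^ (m : ℝ) * 2 * η ^ (-(s - 1)) := by
            rw [show -(s - 1) = 1 + -s by ring, Real.rpow_add hη0, Real.rpow_one]; ring
        _ ≤ 2 ^ (m : ℝ) * 2 * (2 ^ (s - 1) * (1 + η) ^ (-(s - 1))) := by gcongr
        _ = 2 ^ (m + s) * (1 + η) ^ (-(s - 1)) := by
            rw [show (m : ℝ) + s = m + 1 + (s - 1) by ring, Real.rpow_add (by norm_num),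
              Real.rpow_add (by norm_num), Real.rpow_one]
            ring
  calc E ^ m * (|ξ| + a⁻¹ * |ξ|⁻¹) * (1 + ξ ^ 2) ^ (-(s / 2))
      ≤ E ^ m * (l⁻¹ * (η + η⁻¹)) * (l ^ s * η ^ (-s)) := by gcongr
    _ = l ^ (s - 1) * (E ^ m * (η + η⁻¹) * η ^ (-s)) := by
        rw [Real.rpow_sub hl, Real.rpow_one]; field_simp
    _ ≤ l ^ (s - 1) * (2 ^ (m + s) * (1 + η) ^ (-(s - 1))) := by gcongr
    _ = _ := by ring

/-- Size of `m`-th differences of `∂ₓ² w + w / a` for `ŵ = ψ / (iξ)` with `⟨ξ⟩^s ψ ∈ L²`. -/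
lemma exists_difference_bound (hs : 3 / 2 < s) {m : ℕ} (hm : s + 1 ≤ m) :
    ∃ D : ℝ, 0 < D ∧ ∀ (ψ : ℝ → ℂ), AEStronglyMeasurable ψ volume →
      MemLp (sobolevWeighted s ψ) 2 volume → ∀ a l y : ℝ, 0 < l → l ^ 2 ≤ a → 0 ≤ y → y ≤ l →
      ∫ ξ : ℝ, ‖(1 - Complex.exp (Complex.I * ((-(y * ξ) : ℝ) : ℂ))) ^ m
          * (Complex.I * ξ * ψ ξ + ((a⁻¹ : ℝ) : ℂ) * (ψ ξ / (Complex.I * ξ)))‖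
        ≤ D * l ^ (s - 3 / 2) * (eLpNorm (sobolevWeighted s ψ) 2 volume).toReal := by
  set K : ℝ → ℂ := fun η => (((1 + |η|) ^ (-(s - 1)) : ℝ) : ℂ) with hK
  have hKn : ∀ η, ‖K η‖ = (1 + |η|) ^ (-(s - 1)) := fun η => by
    rw [hK, Complex.norm_real, Real.norm_of_nonneg (by positivity)]
  have hKc : Continuous K := Complex.continuous_ofReal.comp
    (Continuous.rpow_const (by fun_prop) fun ξ => Or.inl (by positivity))
  -- Square integrability needs `2(s - 1) > 1`, which is exactly `s > 3/2`.
  have hKi : Integrable (fun η => ‖K η‖ ^ 2) volume := by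
    have := integrable_one_add_norm (E := ℝ) (μ := volume) (r := 2 * (s - 1))
      (by simp; linarith)
    refine this.congr (Filter.Eventually.of_forall fun η => ?_)
    beta_reduce
    rw [hKn, ← Real.rpow_natCast, ← Real.rpow_mul (by positivity), Real.norm_eq_abs]
    congr 1; push_cast; ring
  set N := √(∫ η, ‖K η‖ ^ 2) with hN
  refine ⟨2 ^ (m + s) * (N + 1), by positivity, fun ψ hψ hP a l y hl hla hy hyl => ?_⟩
  have ha : 0 < a := (by positivity : 0 < l ^ 2).trans_le hla
  have hKl : MemLp (fun ξ => K (l * ξ)) 2 volume := by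
    have : Continuous fun ξ => K (l * ξ) := hKc.comp (continuous_const_mul l)
    rw [memLp_two_iff_integrable_sq_norm this.aestronglyMeasurable]
    exact hKi.comp_mul_left' hl.ne'
  -- The dilation costs `l^{-1/2}`, which turns the exponent `s - 1` into `s - 3/2`.
  have hKl' : (eLpNorm (fun ξ => K (l * ξ)) 2 volume).toReal = l ^ (-(1 / 2) : ℝ) * N := by
    rw [toReal_eLpNorm_two hKl, Measure.integral_comp_mul_left (fun ξ => ‖K ξ‖ ^ 2), smul_eq_mul,
      abs_of_pos (by positivity), Real.sqrt_mul (by positivity), Real.rpow_neg hl.le,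
      ← Real.sqrt_eq_rpow, Real.sqrt_inv]
  have hpt : ∀ ξ : ℝ, ‖(1 - Complex.exp (Complex.I * ((-(y * ξ) : ℝ) : ℂ))) ^ m
          * (Complex.I * ξ * ψ ξ + ((a⁻¹ : ℝ) : ℂ) * (ψ ξ / (Complex.I * ξ)))‖
        ≤ 2 ^ (m + s) * l ^ (s - 1) * (‖K (l * ξ)‖ * ‖sobolevWeighted s ψ ξ‖) := by
    intro ξ
    have h1 : ‖Complex.I * ξ * ψ ξ + ((a⁻¹ : ℝ) : ℂ) * (ψ ξ / (Complex.I * ξ))‖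
        ≤ (|ξ| + a⁻¹ * |ξ|⁻¹) * ‖ψ ξ‖ := by
      refine (norm_add_le _ _).trans_eq ?_
      rw [norm_I_mul_mul, norm_mul, norm_div_I_mul, Complex.norm_real,
        Real.norm_of_nonneg (by positivity)]
      ring
    have h2 : ‖ψ ξ‖ = (1 + ξ ^ 2) ^ (-(s / 2)) * ‖sobolevWeighted s ψ ξ‖ := by
      rw [norm_sobolevWeighted, ← mul_assoc, ← Real.rpow_add (by positivity)]; simp
    rw [norm_mul, hKn]
    calc _ ≤ ‖(1 - Complex.exp (Complex.I * ((-(y * ξ) : ℝ) : ℂ))) ^ m‖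
          * ((|ξ| + a⁻¹ * |ξ|⁻¹) * ‖ψ ξ‖) := by gcongr
      _ = (‖(1 - Complex.exp (Complex.I * ((-(y * ξ) : ℝ) : ℂ))) ^ m‖ * (|ξ| + a⁻¹ * |ξ|⁻¹)
          * (1 + ξ ^ 2) ^ (-(s / 2))) * ‖sobolevWeighted s ψ ξ‖ := by rw [h2]; ring
      _ ≤ _ := by
        rw [← mul_assoc]
        exact mul_le_mul_of_nonneg_right
          (difference_multiplier_le (by linarith) hm hl hla hy hyl ξ) (norm_nonneg _)
  calc _ ≤ ∫ ξ, 2 ^ (m + s) * l ^ (s - 1) * (‖K (l * ξ)‖ * ‖sobolevWeighted s ψ ξ‖) := by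
        refine integral_mono_of_nonneg (Filter.Eventually.of_forall fun _ => norm_nonneg _) ?_
          (Filter.Eventually.of_forall hpt)
        exact (hKl.norm.integrable_mul hP.norm).const_mul _
    _ ≤ 2 ^ (m + s) * l ^ (s - 1) * (l ^ (-(1 / 2) : ℝ) * N *
        (eLpNorm (sobolevWeighted s ψ) 2 volume).toReal) := by
        rw [integral_const_mul, ← hKl']
        gcongr
        exact integral_norm_mul_norm_le hKl hP
    _ = 2 ^ (m + s) * N * l ^ (s - 3 / 2) *
        (eLpNorm (sobolevWeighted s ψ) 2 volume).toReal := by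
        rw [show s - 3 / 2 = s - 1 + -(1 / 2) by ring, Real.rpow_add hl]; ring
    _ ≤ _ := by
        gcongr
        linarith

end

/-! ### From the `X^s` norm to interval bounds -/

/-- The sum of the quantities controlled in `L²` by the `X^s` norm, for `u = ∂ₓ w`. -/
def envelope (t : ℝ) (w u u' : ℝ → ℝ) (x : ℝ) : ℝ :=
  |w x| + |u x| + |u' x| + |x * u' x - t * w x|

/-- `u` has the `C²` antiderivative `w`, and all terms of the `X^s` norm of order at most one are
bounded by `X` in `L²`, as expressed on intervals. -/
structure Profile (t X : ℝ) (w u u' : ℝ → ℝ) : Prop where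
  hasDerivAt_w : ∀ x, HasDerivAt w (u x) x
  hasDerivAt_u : ∀ x, HasDerivAt u (u' x) x
  continuous_deriv : Continuous u'
  integral_envelope_le : ∀ p q, p ≤ q → ∫ x in p..q, envelope t w u u' x ≤ 4 * X * √(q - p)

lemma Profile.continuous_w {t X : ℝ} {w u u' : ℝ → ℝ} (h : Profile t X w u u') : Continuous w :=
  continuous_iff_continuousAt.2 fun x => (h.hasDerivAt_w x).continuousAt

lemma Profile.continuous_u {t X : ℝ} {w u u' : ℝ → ℝ} (h : Profile t X w u u') : Continuous u :=
  continuous_iff_continuousAt.2 fun x => (h.hasDerivAt_u x).continuousAt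

lemma Profile.continuous_envelope {t X : ℝ} {w u u' : ℝ → ℝ} (h : Profile t X w u u') :
    Continuous (envelope t w u u') := by
  have := h.continuous_w
  have := h.continuous_u
  have := h.continuous_deriv
  unfold envelope
  fun_prop

lemma envelope_nonneg (t : ℝ) (w u u' : ℝ → ℝ) (x : ℝ) : 0 ≤ envelope t w u u' x := by
  unfold envelope; positivity

/-- Cauchy–Schwarz against the constant `1`: from here on, `L²` information is used only through
integrals over intervals. -/
lemma intervalIntegral_norm_le {h : ℝ → ℂ} {X : ℝ≥0∞} (hX : X ≠ ⊤)
    (hh : AEStronglyMeasurable h volume) (hle : eLpNorm h 2 volume ≤ X) {p q : ℝ} (hpq : p ≤ q) :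
    ∫ x in p..q, ‖h x‖ ≤ X.toReal * √(q - p) := by
  have hm : MemLp h 2 volume := ⟨hh, hle.trans_lt hX.lt_top⟩
  set μ := volume.restrict (Ioc p q)
  have h1 : MemLp (fun _ : ℝ => (1 : ℂ)) 2 μ := memLp_const 1
  have := integral_norm_mul_norm_le (hm.restrict (Ioc p q)) h1
  rw [intervalIntegral.integral_of_le hpq]
  simp only [norm_one, mul_one] at this
  refine this.trans ?_
  have h2 : (eLpNorm (fun _ : ℝ => (1 : ℂ)) 2 μ).toReal = √(q - p) := by
    rw [toReal_eLpNorm_two h1]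
    simp [μ, hpq]
  rw [h2]
  gcongr
  exact (eLpNorm_restrict_le _ _ _ _).trans hle

lemma sobolevNorm_le_xNorm (s t : ℝ) (f : ℝ → ℝ) :
    sobolevNorm s (fun x => (f x : ℂ)) ≤ xNorm s t f := by
  rw [xNorm, one_div, ENNReal.le_rpow_inv_iff (by norm_num), ENNReal.rpow_ofNat, add_assoc]
  exact le_self_add

lemma homSobolevNorm_le_xNorm (s t : ℝ) (f : ℝ → ℝ) :
    homSobolevNorm (-1) (fun x => (f x : ℂ)) ≤ xNorm s t f := by
  rw [xNorm, one_div, ENNReal.le_rpow_inv_iff (by norm_num), ENNReal.rpow_ofNat]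
  exact le_add_self.trans le_self_add

lemma eLpNorm_JDx_le_xNorm (s t : ℝ) (f : ℝ → ℝ) :
    eLpNorm (JDx t (fun x => (f x : ℂ))) 2 volume ≤ xNorm s t f := by
  rw [xNorm, one_div, ENNReal.le_rpow_inv_iff (by norm_num), ENNReal.rpow_ofNat]
  exact le_add_self

/-- This is where Fourier analysis ends: what follows uses only the antiderivative `w`, the interval
bounds and the difference bound. The functions `w` and `f'` are real parts of Fourier integrals with
symbols `f̂ / (iξ)` and `iξ f̂`. -/
lemma exists_profile {s : ℝ} (hs : 2 ≤ s) {m : ℕ} (hm : s + 1 ≤ m) :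
    ∃ D : ℝ, 0 < D ∧ ∀ (t : ℝ) (f : ℝ → ℝ), MemX s t f → ∃ w f' : ℝ → ℝ,
      Profile t (xNorm s t f).toReal w f f' ∧
      ∀ a l y x : ℝ, 0 < l → l ^ 2 ≤ a → 0 ≤ y → y ≤ l →
        |∑ j ∈ Finset.range (m + 1), (-1) ^ j * (m.choose j : ℝ)
            * (f' (x - j * y) + a⁻¹ * w (x - j * y))|
          ≤ D * l ^ (s - 3 / 2) * (xNorm s t f).toReal := by
  obtain ⟨D, hD, hdiff⟩ := exists_difference_bound (by linarith : 3 / 2 < s) hm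
  refine ⟨D, hD, fun t f hf => ?_⟩
  set F : ℝ → ℂ := fun x => (f x : ℂ) with hF
  set X := xNorm s t f with hX
  have hXt : X ≠ ⊤ := hf.xNorm_lt_top.ne
  have hFm : MemLp F 2 volume := hf.memLp.ofReal
  set ψ := fourierL2 F with hψ
  have hψm : AEStronglyMeasurable ψ volume := aestronglyMeasurable_fourierL2 F
  have hPX : eLpNorm (sobolevWeighted s ψ) 2 volume ≤ X := sobolevNorm_le_xNorm s t f
  have hPc : AEStronglyMeasurable (sobolevWeighted s ψ) volume := by
    refine AEStronglyMeasurable.mul (Continuous.aestronglyMeasurable ?_) hψm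
    exact Complex.continuous_ofReal.comp
      (Continuous.rpow_const (by fun_prop) fun ξ => Or.inl (by positivity))
  have hP : MemLp (sobolevWeighted s ψ) 2 volume := ⟨hPc, hPX.trans_lt hf.xNorm_lt_top⟩
  have hQX : eLpNorm (fun ξ : ℝ => ψ ξ / (Complex.I * ξ)) 2 volume ≤ X := by
    refine le_trans (le_of_eq ?_) (homSobolevNorm_le_xNorm s t f)
    refine eLpNorm_congr_norm_ae (Filter.Eventually.of_forall fun ξ => ?_)
    rw [norm_div_I_mul, norm_mul, Complex.norm_real, Real.rpow_neg_one, norm_inv, norm_abs_eq_norm,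
      Real.norm_eq_abs]
  have hQ : MemLp (fun ξ : ℝ => ψ ξ / (Complex.I * ξ)) 2 volume :=
    ⟨aestronglyMeasurable_div_I_mul hψm, hQX.trans_lt hf.xNorm_lt_top⟩
  have iψ : Integrable ψ volume := integrable_of_sobolev hs hψm hP
  have iQ := integrable_div_of_sobolev hs hψm hP hQ
  have iV := integrable_mul_of_sobolev hs hψm hP
  have mV := memLp_mul_of_sobolev (by linarith : 1 ≤ s) hψm hP
  set W := synth (fun ξ : ℝ => ψ ξ / (Complex.I * ξ)) with hW
  set V := synth (fun ξ : ℝ => Complex.I * ξ * ψ ξ) with hV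
  -- Inversion holds only almost everywhere; continuity of both sides upgrades it to equality at
  -- every point, so that `F` can be differentiated.
  have hFU : F = synth ψ := by
    have hc : Continuous F := Complex.continuous_ofReal.comp hf.continuous
    exact (hc.ae_eq_iff_eq volume (continuous_synth iψ)).1 (ae_eq_synth_fourierL2 hFm iψ)
  have hdF : ∀ x, HasDerivAt F (V x) x := by
    intro x
    rw [hFU]
    exact hasDerivAt_synth iψ iV x
  have hdW : ∀ x, HasDerivAt W (F x) x := by
    intro x
    -- Cancellation of `iξ` can fail only at `ξ = 0`, a null set.
    have hcong : (fun ξ : ℝ => Complex.I * ξ * (ψ ξ / (Complex.I * ξ))) =ᵐ[volume] ψ := by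
      have : ∀ᵐ ξ : ℝ, ξ ≠ 0 := by simp [ae_iff]
      filter_upwards [this] with ξ hξ
      have : (ξ : ℂ) ≠ 0 := by exact_mod_cast hξ
      field_simp [Complex.I_ne_zero]
    have h1 := hasDerivAt_synth iQ (iψ.congr hcong.symm) x
    have h2 : synth (fun ξ : ℝ => Complex.I * ξ * (ψ ξ / (Complex.I * ξ))) x = F x := by
      rw [hFU, synth, synth]
      congr 1
      refine integral_congr_ae ?_
      filter_upwards [hcong] with ξ hξ
      rw [hξ]
    rwa [h2] at h1
  have cW : Continuous W := continuous_synth iQ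
  have cV : Continuous V := continuous_synth iV
  have cF : Continuous F := Complex.continuous_ofReal.comp hf.continuous
  have nW : eLpNorm W 2 volume ≤ X := by rw [hW, eLpNorm_synth iQ hQ]; exact hQX
  have nF : eLpNorm F 2 volume ≤ X := by
    rw [← eLpNorm_fourierL2 hFm]
    exact (eLpNorm_mono (norm_le_norm_sobolevWeighted (by linarith) ψ)).trans hPX
  have nV : eLpNorm V 2 volume ≤ X := by
    rw [hV, eLpNorm_synth iV mV]
    exact (eLpNorm_mono (norm_I_mul_mul_le (by linarith) ψ)).trans hPX
  -- The `deriv` in `JDx` is `V` everywhere, while `invDx` agrees with `W` almost everywhere, which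
  -- is enough for the norm.
  have nG : eLpNorm (fun x : ℝ => (x : ℂ) * V x - t * W x) 2 volume ≤ X := by
    refine le_trans (le_of_eq ?_) (eLpNorm_JDx_le_xNorm s t f)
    refine eLpNorm_congr_ae ?_
    filter_upwards [fourierInvL2_ae_eq_synth iQ hQ] with x hx
    rw [JDx, invDx, (hdF x).deriv, ← hψ, hx]
  have hre : ∀ {g : ℝ → ℂ} {g' : ℂ} {x : ℝ}, HasDerivAt g g' x →
      HasDerivAt (fun x => (g x).re) g'.re x := fun h =>
    (Complex.reCLM.hasFDerivAt.comp_hasDerivAt _ h)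
  have cG : Continuous fun x : ℝ => (x : ℂ) * V x - t * W x := by fun_prop
  refine ⟨fun x => (W x).re, fun x => (V x).re, ⟨fun x => ?_, fun x => ?_, by fun_prop, ?_⟩, ?_⟩
  · simpa [hF] using hre (hdW x)
  · simpa [hF] using hre (hdF x)
  · intro p q hpq
    have hle : ∀ x, envelope t (fun x => (W x).re) f (fun x => (V x).re) x
        ≤ ‖W x‖ + ‖F x‖ + ‖V x‖ + ‖(x : ℂ) * V x - t * W x‖ := by
      intro x
      have h1 := Complex.abs_re_le_norm (W x)
      have h2 := Complex.abs_re_le_norm (V x)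
      have h3 := Complex.abs_re_le_norm ((x : ℂ) * V x - t * W x)
      have h4 : |f x| = ‖F x‖ := by simp [hF]
      simp only [Complex.sub_re, Complex.re_ofReal_mul] at h3
      rw [envelope, h4]
      linarith
    have cE : Continuous (envelope t (fun x => (W x).re) f (fun x => (V x).re)) := by
      have := hf.continuous
      unfold envelope
      fun_prop
    calc _ ≤ ∫ x in p..q, (‖W x‖ + ‖F x‖ + ‖V x‖ + ‖(x : ℂ) * V x - t * W x‖) :=
          intervalIntegral.integral_mono_on hpq (cE.intervalIntegrable _ _)
            (Continuous.intervalIntegrable (by fun_prop) _ _) fun x _ => hle x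
      _ = (∫ x in p..q, ‖W x‖) + (∫ x in p..q, ‖F x‖) + (∫ x in p..q, ‖V x‖)
          + ∫ x in p..q, ‖(x : ℂ) * V x - t * W x‖ := by
          rw [intervalIntegral.integral_add, intervalIntegral.integral_add,
            intervalIntegral.integral_add] <;>
          exact Continuous.intervalIntegrable (by fun_prop) _ _
      _ ≤ X.toReal * √(q - p) + X.toReal * √(q - p) + X.toReal * √(q - p)
          + X.toReal * √(q - p) := by
          gcongr
          · exact intervalIntegral_norm_le hXt cW.aestronglyMeasurable nW hpq
          · exact intervalIntegral_norm_le hXt cF.aestronglyMeasurable nF hpq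
          · exact intervalIntegral_norm_le hXt cV.aestronglyMeasurable nV hpq
          · exact intervalIntegral_norm_le hXt cG.aestronglyMeasurable nG hpq
      _ = _ := by ring
  · intro a l y x hl hla hy hyl
    set H : ℝ → ℂ := fun ξ => Complex.I * ξ * ψ ξ + ((a⁻¹ : ℝ) : ℂ) * (ψ ξ / (Complex.I * ξ))
    have iH : Integrable H volume := iV.add (iQ.const_mul _)
    have hH : ∀ z, (V z).re + a⁻¹ * (W z).re = (synth H z).re := by
      intro z
      rw [synth_add_const_mul iV iQ, Complex.add_re, Complex.re_ofReal_mul]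
    have hsum : ∑ j ∈ Finset.range (m + 1), (-1) ^ j * (m.choose j : ℝ)
            * ((V (x - j * y)).re + a⁻¹ * (W (x - j * y)).re)
        = (synth (fun ξ : ℝ => (1 - Complex.exp (Complex.I * ((-(y * ξ) : ℝ) : ℂ))) ^ m * H ξ) x).re := by
      rw [← sum_choose_synth iH, Complex.re_sum]
      refine Finset.sum_congr rfl fun j _ => ?_
      rw [hH, Complex.re_ofReal_mul]
    rw [hsum]
    refine (Complex.abs_re_le_norm _).trans ((norm_synth_le _ _).trans ?_)
    refine (hdiff ψ hψm hP a l y hl hla hy hyl).trans ?_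
    gcongr

/-! ### Pointwise smallness of `u' + w / a` -/

/-- To the left of `-ta`, the equation `x u' - t w = g` makes `u' + w / a` smaller than
`|w| + |u'| + |g|` by a factor `ta`. -/
lemma abs_deriv_add_le {t w u' g a l x d : ℝ} {m : ℕ} (ha : 0 < a) (hta : 1 ≤ t * a)
    (ht : 1 ≤ t) (hl : 0 < l) (hl1 : l ≤ 1) (hd : 0 ≤ d) (hdl : d ≤ m * l) (hx : x = -(t * a) - d)
    (hg : g = x * u' - t * w) :
    |u' + a⁻¹ * w| ≤ (1 + m * (1 + m)) * (|w| + |u'| + |g|) / (t * a) := by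
  have hta0 : 0 < t * a := by linarith
  have hm : (0 : ℝ) ≤ m := by positivity
  have hxa : |x| = t * a + d := by rw [hx, abs_of_nonpos (by linarith)]; ring
  have key : l / a * |w| ≤ (1 + m) * (|w| + |u'| + |g|) := by
    rcases le_total 1 a with h | h
    -- For `a ≥ 1` the coefficient is harmless. For `a ≤ 1` the factor `1/a` is recovered by solving
    -- the equation for `t w`.
    · have : l / a ≤ 1 := (div_le_one ha).2 (hl1.trans h)
      nlinarith [abs_nonneg w, abs_nonneg u', abs_nonneg g]
    · have h1 : t * |w| ≤ (t * a + d) * |u'| + |g| := by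
        have h2 : t * w = x * u' - g := by rw [hg]; ring
        calc t * |w| = |t * w| := by rw [abs_mul, abs_of_nonneg (by linarith : 0 ≤ t)]
          _ ≤ |x * u'| + |g| := by rw [h2]; exact abs_sub _ _
          _ = _ := by rw [abs_mul, hxa]
      have h2 : l / (t * a) ≤ 1 := (div_le_one hta0).2 (hl1.trans hta)
      have h3 : l / (t * a) * (t * a + d) ≤ 1 + m := by
        have hd' : d ≤ m := hdl.trans (mul_le_of_le_one_right hm hl1)
        have : l / (t * a) * (t * a + d) = l + l / (t * a) * d := by field_simp
        rw [this]
        nlinarith [div_nonneg hl.le hta0.le]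
      calc l / a * |w| = l / (t * a) * (t * |w|) := by field_simp
        _ ≤ l / (t * a) * ((t * a + d) * |u'| + |g|) := by gcongr
        _ = l / (t * a) * (t * a + d) * |u'| + l / (t * a) * |g| := by ring
        _ ≤ (1 + m) * |u'| + 1 * |g| := by gcongr
        _ ≤ _ := by nlinarith [abs_nonneg w, abs_nonneg u', abs_nonneg g,
            mul_nonneg hm (abs_nonneg g), mul_nonneg hm (abs_nonneg w)]
  -- At `x = -ta` exactly, the `w` terms would cancel; moving left by `d` leaves the remainder `(d /
  -- a) w`.
  have hxH : x * (u' + a⁻¹ * w) = g - d / a * w := by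
    rw [hg, hx]; field_simp; ring
  have h4 : (t * a) * |u' + a⁻¹ * w| ≤ |g| + d / a * |w| := by
    calc (t * a) * |u' + a⁻¹ * w| ≤ |x| * |u' + a⁻¹ * w| := by
          gcongr; linarith
      _ = |g - d / a * w| := by rw [← abs_mul, hxH]
      _ ≤ |g| + |d / a * w| := abs_sub _ _
      _ = |g| + d / a * |w| := by rw [abs_mul, abs_of_nonneg (by positivity : 0 ≤ d / a)]
  have h5 : d / a * |w| ≤ m * ((1 + m) * (|w| + |u'| + |g|)) := by
    calc d / a * |w| ≤ m * l / a * |w| := by gcongr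
      _ = m * (l / a * |w|) := by ring
      _ ≤ _ := by gcongr
  rw [le_div_iff₀ hta0]
  nlinarith [abs_nonneg w, abs_nonneg u', abs_nonneg g]

/-- In an `m`-th backward difference the value at `x₀` has coefficient `1`, and every other node
lies to the left of `x₀`, where `abs_deriv_add_le` gains `1/(ta)`. Averaging over the step `y ∈ [0,
l]` replaces pointwise values of the envelope by its integrals, each at most `4X√l`. -/
lemma Profile.abs_deriv_add_le_of_difference {t X : ℝ} {w u u' : ℝ → ℝ} (h : Profile t X w u u')
    (hX : 0 ≤ X) {a l B : ℝ} {m : ℕ} (ha : 0 < a) (hta : 1 ≤ t * a) (ht : 1 ≤ t) (hl : 0 < l)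
    (hl1 : l ≤ 1) (hB : ∀ y, 0 ≤ y → y ≤ l →
      |∑ j ∈ Finset.range (m + 1), (-1) ^ j * (m.choose j : ℝ)
        * (u' (-(t * a) - j * y) + a⁻¹ * w (-(t * a) - j * y))| ≤ B) :
    |u' (-(t * a)) + a⁻¹ * w (-(t * a))|
      ≤ B + 2 ^ m * (1 + m * (1 + m)) * 4 * X * (l ^ (-(1 / 2) : ℝ) / (t * a)) := by
  have hta0 : 0 < t * a := by linarith
  set H : ℝ → ℝ := fun x => u' x + a⁻¹ * w x with hH
  set K : ℝ := 1 + m * (1 + m) with hK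
  have hK0 : 0 ≤ K := by positivity
  set x₀ := -(t * a) with hx₀
  have hHc : Continuous H := by
    have := h.continuous_w
    have := h.continuous_deriv
    fun_prop
  have hEc := h.continuous_envelope
  -- The `j = 0` term does not depend on `y`; the remaining terms are moved to the right side.
  have hpt : ∀ y ∈ Icc 0 l, |H x₀| ≤ B + ∑ j ∈ Finset.range m, (m.choose (j + 1) : ℝ)
      * (K / (t * a) * envelope t w u u' (x₀ - (j + 1 : ℕ) * y)) := by
    intro y hy
    have h1 := hB y hy.1 hy.2
    rw [Finset.sum_range_succ'] at h1
    simp only [pow_zero, Nat.choose_zero_right, Nat.cast_one, Nat.cast_zero, zero_mul, sub_zero,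
      one_mul, mul_one] at h1
    set T := ∑ j ∈ Finset.range m, (-1) ^ (j + 1) * (m.choose (j + 1) : ℝ)
        * (u' (x₀ - (j + 1 : ℕ) * y) + a⁻¹ * w (x₀ - (j + 1 : ℕ) * y)) with hT
    have h2 : |T| ≤ ∑ j ∈ Finset.range m, (m.choose (j + 1) : ℝ)
        * (K / (t * a) * envelope t w u u' (x₀ - (j + 1 : ℕ) * y)) := by
      refine (Finset.abs_sum_le_sum_abs _ _).trans (Finset.sum_le_sum fun j hj => ?_)
      rw [abs_mul, abs_mul, abs_pow, abs_neg, abs_one, one_pow, one_mul, Nat.abs_cast]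
      gcongr
      have hj' : ((j + 1 : ℕ) : ℝ) ≤ m := by exact_mod_cast Finset.mem_range.1 hj
      refine (abs_deriv_add_le (m := m) (d := (j + 1 : ℕ) * y) ha hta ht hl hl1 ?_ ?_ rfl rfl).trans ?_
      · exact mul_nonneg (by positivity) hy.1
      · exact mul_le_mul hj' hy.2 hy.1 (by positivity)
      · rw [mul_div_right_comm]
        unfold envelope
        gcongr
        linarith [abs_nonneg (u (x₀ - (j + 1 : ℕ) * y))]
    have h3 : |H x₀| ≤ |T + H x₀| + |T| := by
      have := abs_sub (T + H x₀) T
      rwa [add_sub_cancel_left] at this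
    linarith
  have hint : ∀ j : ℕ, ∫ y in (0 : ℝ)..l, envelope t w u u' (x₀ - (j + 1 : ℕ) * y)
      ≤ 4 * X * √l := by
    intro j
    have hj : (0 : ℝ) < (j + 1 : ℕ) := by positivity
    rw [intervalIntegral.integral_comp_sub_mul _ hj.ne', smul_eq_mul, mul_zero, sub_zero]
    have h1 := h.integral_envelope_le (x₀ - (j + 1 : ℕ) * l) x₀
      (by linarith [mul_pos hj hl])
    rw [sub_sub_cancel, Real.sqrt_mul hj.le] at h1
    -- The substitution contributes `1/(j+1)` and the longer interval `√(j+1)`, so the bound is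
    -- uniform in `j`.
    have h2 : √((j + 1 : ℕ) : ℝ) ≤ (j + 1 : ℕ) := by
      rw [Real.sqrt_le_left hj.le]
      have : (1 : ℝ) ≤ (j + 1 : ℕ) := by simp
      nlinarith
    rw [inv_mul_le_iff₀ hj]
    refine h1.trans ?_
    calc 4 * X * (√((j + 1 : ℕ) : ℝ) * √l) ≤ 4 * X * ((j + 1 : ℕ) * √l) := by gcongr
      _ = _ := by ring
  have hEj : ∀ j : ℕ, Continuous fun y : ℝ => (m.choose (j + 1) : ℝ)
      * (K / (t * a) * envelope t w u u' (x₀ - (j + 1 : ℕ) * y)) := by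
    intro j
    have : Continuous fun y : ℝ => envelope t w u u' (x₀ - (j + 1 : ℕ) * y) :=
      hEc.comp (by fun_prop)
    fun_prop
  have hsum : ∑ j ∈ Finset.range m, (m.choose (j + 1) : ℝ) ≤ 2 ^ m := by
    have := Nat.sum_range_choose m
    rw [Finset.sum_range_succ'] at this
    have h2 : ∑ j ∈ Finset.range m, m.choose (j + 1) ≤ 2 ^ m := by omega
    exact_mod_cast h2
  have hmain : l * |H x₀| ≤ l * B + 2 ^ m * (K / (t * a) * (4 * X * √l)) := by
    calc l * |H x₀| = ∫ y in (0 : ℝ)..l, |H x₀| := by simp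
      _ ≤ ∫ y in (0 : ℝ)..l, (B + ∑ j ∈ Finset.range m, (m.choose (j + 1) : ℝ)
          * (K / (t * a) * envelope t w u u' (x₀ - (j + 1 : ℕ) * y))) := by
          refine intervalIntegral.integral_mono_on hl.le (by simp) ?_ hpt
          exact (continuous_const.add
            (continuous_finsetSum _ fun j _ => hEj j)).intervalIntegrable _ _
      _ = l * B + ∑ j ∈ Finset.range m, (m.choose (j + 1) : ℝ) * (K / (t * a) *
          ∫ y in (0 : ℝ)..l, envelope t w u u' (x₀ - (j + 1 : ℕ) * y)) := by
          rw [intervalIntegral.integral_add (by simp)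
            ((continuous_finsetSum _ fun j _ => hEj j).intervalIntegrable _ _),
            intervalIntegral.integral_finsetSum fun j _ => (hEj j).intervalIntegrable _ _]
          simp [intervalIntegral.integral_const_mul]
      _ ≤ l * B + ∑ j ∈ Finset.range m, (m.choose (j + 1) : ℝ) * (K / (t * a) * (4 * X * √l)) := by
          gcongr with j _
          exact hint j
      _ ≤ _ := by
          rw [← Finset.sum_mul]
          gcongr
  -- Dividing the averaged inequality by `l` leaves `√l / l = l^{-1/2}`.
  have hsq : √l = l * l ^ (-(1 / 2) : ℝ) := by
    rw [Real.sqrt_eq_rpow]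
    nth_rw 2 [← Real.rpow_one l]
    rw [← Real.rpow_add hl]; norm_num
  rw [hsq] at hmain
  refine le_of_mul_le_mul_left (hmain.trans_eq ?_) hl
  field_simp

/-! ### The amplitude and its slow variation -/

/-- Half the modulus of the phase, `√(t|x|)` for `x < 0`. -/
def halfPhase (t x : ℝ) : ℝ := √(t * -x)

lemma hasDerivAt_halfPhase {t x : ℝ} (h : 0 < t * -x) :
    HasDerivAt (halfPhase t) (-t / (2 * halfPhase t x)) x := by
  have h1 : HasDerivAt (fun x : ℝ => t * -x) (-t) x := by
    simpa using ((hasDerivAt_id x).neg).const_mul t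
  exact h1.sqrt h.ne'

/-- The slowly varying complex amplitude of the wave `w` with derivative `u`. -/
def amplitude (t r : ℝ) (w u : ℝ → ℝ) (x : ℝ) : ℂ :=
  ((2 * r)⁻¹ : ℝ) * (Complex.exp (Complex.I * ((2 * halfPhase t x : ℝ) : ℂ))
    * (w x - Complex.I * ((u x * halfPhase t x / t : ℝ) : ℂ)))

/-- The derivative of `amplitude`. -/
def amplitudeDeriv (t r : ℝ) (w u u' : ℝ → ℝ) (x : ℝ) : ℂ :=
  ((2 * r * halfPhase t x)⁻¹ : ℝ) * (Complex.I *
    (Complex.exp (Complex.I * ((2 * halfPhase t x : ℝ) : ℂ))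
      * ((x * u' x - t * w x + u x / 2 : ℝ) : ℂ)))

section

variable {t X r R : ℝ} {w u u' : ℝ → ℝ}

lemma hasDerivAt_cexp_halfPhase (n : ℝ) {x : ℝ} (h : 0 < t * -x) :
    HasDerivAt (fun x => Complex.exp (Complex.I * ((n * halfPhase t x : ℝ) : ℂ)))
      (Complex.exp (Complex.I * ((n * halfPhase t x : ℝ) : ℂ))
        * (Complex.I * ((n * (-t / (2 * halfPhase t x)) : ℝ) : ℂ))) x :=
  ((((hasDerivAt_halfPhase h).const_mul n).ofReal_comp).const_mul Complex.I).cexp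

/-- Differentiating the phase cancels all terms except `x w'' - t w + w'/2`, the equation solved
exactly by `e^{±2ip}`; hence no large factor survives. -/
lemma Profile.hasDerivAt_amplitude (h : Profile t X w u u') (ht : 0 < t) (hr : 0 < r) {x : ℝ}
    (hx : x < 0) :
    HasDerivAt (amplitude t r w u) (amplitudeDeriv t r w u u' x) x := by
  have htx : 0 < t * -x := mul_pos ht (by linarith)
  have hp : 0 < halfPhase t x := Real.sqrt_pos.2 htx
  have hp2 : halfPhase t x ^ 2 = t * -x := Real.sq_sqrt htx.le
  have h1 := hasDerivAt_cexp_halfPhase 2 htx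
  have h2 := (((h.hasDerivAt_u x).mul (hasDerivAt_halfPhase htx)).div_const t).ofReal_comp
  have h3 := (h.hasDerivAt_w x).ofReal_comp.sub (h2.const_mul Complex.I)
  have h4 := (h1.mul h3).const_mul (((2 * r)⁻¹ : ℝ) : ℂ)
  refine h4.congr_deriv ?_
  rw [amplitudeDeriv]
  set p := halfPhase t x with hpdef
  have hxp : x = -(p ^ 2 / t) := by rw [hp2]; field_simp
  have hpC : (p : ℂ) ≠ 0 := by exact_mod_cast hp.ne'
  have htC : (t : ℂ) ≠ 0 := by exact_mod_cast ht.ne'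
  have hrC : (r : ℂ) ≠ 0 := by exact_mod_cast hr.ne'
  simp only [Pi.mul_apply, Pi.sub_apply]
  rw [← hpdef]
  have hxC : (x : ℂ) = -(p ^ 2 / t) := by rw [hxp]; push_cast; ring
  set e := Complex.exp (Complex.I * ((2 * p : ℝ) : ℂ))
  push_cast
  rw [hxC]
  field_simp
  ring_nf
  simp only [Complex.I_sq]
  ring

/-- Since `w` and `u` are real, `B` and its conjugate are two equations that can be solved for `u`.
The first term is resonant; the second oscillates at twice the phase. -/
lemma ofReal_mul_cexp_eq (ht : 0 < t) (hr : 0 < r) (w u : ℝ → ℝ) {x : ℝ} (hx : x < 0) :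
    (u x : ℂ) * Complex.exp (Complex.I * ((2 * halfPhase t x : ℝ) : ℂ))
      = Complex.I * ((t * r / halfPhase t x : ℝ) : ℂ) * (amplitude t r w u x
        - conj (amplitude t r w u x) * Complex.exp (Complex.I * ((4 * halfPhase t x : ℝ) : ℂ))) := by
  have htx : 0 < t * -x := mul_pos ht (by linarith)
  have hp : 0 < halfPhase t x := Real.sqrt_pos.2 htx
  rw [amplitude]
  set p := halfPhase t x with hpdef
  have hpC : (p : ℂ) ≠ 0 := by exact_mod_cast hp.ne'
  have htC : (t : ℂ) ≠ 0 := by exact_mod_cast ht.ne'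
  have hrC : (r : ℂ) ≠ 0 := by exact_mod_cast hr.ne'
  have he : conj (Complex.exp (Complex.I * ((2 * p : ℝ) : ℂ)))
      * Complex.exp (Complex.I * ((4 * p : ℝ) : ℂ))
      = Complex.exp (Complex.I * ((2 * p : ℝ) : ℂ)) := by
    rw [← Complex.exp_conj, map_mul, Complex.conj_I, Complex.conj_ofReal, ← Complex.exp_add]
    congr 1; push_cast; ring
  simp only [map_mul, map_sub, Complex.conj_I, Complex.conj_ofReal]
  set e := Complex.exp (Complex.I * ((2 * p : ℝ) : ℂ))
  set e' := Complex.exp (Complex.I * ((4 * p : ℝ) : ℂ))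
  have : (((2 * r)⁻¹ : ℝ) : ℂ) * (conj e * (w x - -Complex.I * ((u x * p / t : ℝ) : ℂ))) * e'
      = (((2 * r)⁻¹ : ℝ) : ℂ) * ((conj e * e') * (w x - -Complex.I * ((u x * p / t : ℝ) : ℂ))) := by
    ring
  rw [this, he]
  push_cast
  field_simp
  ring_nf
  simp only [Complex.I_sq]
  ring

/-- Bounds for `halfPhase` on the support of the wave packet. -/
lemma halfPhase_bounds (ht : 1 ≤ t) (hr : 0 < r) (hR : 0 < R) (hRa : R ≤ t * r ^ 2) {x : ℝ}
    (hx : x ∈ Icc (-(t * r ^ 2) - R / 2) (-(t * r ^ 2) + R / 2)) :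
    x < 0 ∧ t * r / 2 ≤ halfPhase t x ∧ halfPhase t x ≤ 2 * (t * r) ∧
      |t * r / halfPhase t x - 1| ≤ R / (t * r ^ 2) := by
  have ht0 : 0 < t := by linarith
  have hta : 0 < t * r ^ 2 := by positivity
  have htr : 0 < t * r := by positivity
  have hx0 : x < 0 := by linarith [hx.2]
  have htx : 0 < t * -x := mul_pos ht0 (by linarith)
  have hp : 0 < halfPhase t x := Real.sqrt_pos.2 htx
  have hp2 : halfPhase t x ^ 2 = t * -x := Real.sq_sqrt htx.le
  set p := halfPhase t x
  have h1 : t * r / 2 ≤ p := by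
    refine (sq_le_sq₀ (by positivity) hp.le).1 ?_
    nlinarith [hx.2]
  refine ⟨hx0, h1, ?_, ?_⟩
  · refine (sq_le_sq₀ hp.le (by positivity)).1 ?_
    nlinarith [hx.1]
  -- Difference of squares: `(tr)² - p² = t (t r² + x)`.
  · have h2 : (t * r / p - 1) * (p * (t * r + p)) = t * (t * r ^ 2 + x) := by
      field_simp
      nlinarith
    have h3 : |t * r / p - 1| * (p * (t * r + p)) ≤ t * (R / 2) := by
      rw [← abs_of_pos (by positivity : 0 < p * (t * r + p)), ← abs_mul, h2, abs_mul,
        abs_of_pos ht0]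
      gcongr
      rw [abs_le]
      constructor <;> linarith [hx.1, hx.2]
    have h4 : t * r / 2 * (t * r) ≤ p * (t * r + p) := by gcongr; linarith
    rw [le_div_iff₀ hta]
    have h5 : |t * r / p - 1| * (t * r / 2 * (t * r)) ≤ t * (R / 2) :=
      (mul_le_mul_of_nonneg_left h4 (abs_nonneg _)).trans h3
    nlinarith

lemma norm_amplitudeDeriv_le (ht : 1 ≤ t) (hr : 0 < r) (hR : 0 < R) (hRa : R ≤ t * r ^ 2) {x : ℝ}
    (hx : x ∈ Icc (-(t * r ^ 2) - R / 2) (-(t * r ^ 2) + R / 2)) :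
    ‖amplitudeDeriv t r w u u' x‖ ≤ (t * r ^ 2)⁻¹ * envelope t w u u' x := by
  obtain ⟨hx0, h1, -, -⟩ := halfPhase_bounds ht hr hR hRa hx
  have htr : 0 < t * r := by positivity
  have hp : 0 < halfPhase t x := by linarith
  rw [amplitudeDeriv, norm_mul, norm_mul, norm_mul, norm_cexp_I_mul_ofReal, Complex.norm_I,
    Complex.norm_real, Complex.norm_real, one_mul, one_mul, Real.norm_of_nonneg (by positivity)]
  have h2 : (2 * r * halfPhase t x)⁻¹ ≤ (t * r ^ 2)⁻¹ :=
    inv_anti₀ (by positivity) (by nlinarith)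
  have h3 : ‖x * u' x - t * w x + u x / 2‖ ≤ envelope t w u u' x := by
    rw [Real.norm_eq_abs, envelope]
    have := abs_add_le (x * u' x - t * w x) (u x / 2)
    rw [abs_div, abs_two] at this
    linarith [abs_nonneg (w x), abs_nonneg (u x), abs_nonneg (u' x)]
  gcongr

/-- The danger is the term `|w| / (2r)` for small `r`. There `t w = x u' - g` with `|x| ≤ 2 t r²`
makes `w` itself of size `r`, the term with `g` being handled by `tr ≥ 1`. -/
lemma norm_amplitude_le (ht : 1 ≤ t) (hr : 0 < r) (hR : 0 < R) (hRa : R ≤ t * r ^ 2)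
    (htr : 1 ≤ t * r) {x : ℝ} (hx : x ∈ Icc (-(t * r ^ 2) - R / 2) (-(t * r ^ 2) + R / 2)) :
    ‖amplitude t r w u x‖ ≤ envelope t w u u' x := by
  obtain ⟨hx0, h1, h2, -⟩ := halfPhase_bounds ht hr hR hRa hx
  have ht0 : 0 < t := by linarith
  have hp : 0 < halfPhase t x := by linarith
  set p := halfPhase t x with hpdef
  have hn : ‖(w x : ℂ) - Complex.I * ((u x * p / t : ℝ) : ℂ)‖ ≤ |w x| + |u x| * (2 * r) := by
    refine (norm_sub_le _ _).trans ?_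
    rw [norm_mul, Complex.norm_I, one_mul, Complex.norm_real, Complex.norm_real,
      Real.norm_eq_abs, Real.norm_eq_abs, abs_div, abs_mul, abs_of_pos hp, abs_of_pos ht0,
      mul_div_assoc]
    gcongr
    rw [div_le_iff₀ ht0]
    linarith
  have hw : |w x| ≤ (|w x| + |u' x| + |x * u' x - t * w x|) * (2 * r) := by
    rcases le_total 1 r with h | h
    · nlinarith [abs_nonneg (w x), abs_nonneg (u' x), abs_nonneg (x * u' x - t * w x)]
    · have hxa : |x| ≤ 2 * (t * r ^ 2) := by
        rw [abs_of_neg hx0]; linarith [hx.1]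
      have h3 : t * |w x| ≤ 2 * (t * r ^ 2) * |u' x| + |x * u' x - t * w x| := by
        calc t * |w x| = |x * u' x - (x * u' x - t * w x)| := by
              rw [sub_sub_cancel, abs_mul, abs_of_pos ht0]
          _ ≤ |x| * |u' x| + |x * u' x - t * w x| := by rw [← abs_mul]; exact abs_sub _ _
          _ ≤ _ := by gcongr
      have h4 : 2 * (t * r ^ 2) * |u' x| ≤ t * (|u' x| * (2 * r)) := by
        have : t * r ^ 2 ≤ t * r := by nlinarith
        nlinarith [abs_nonneg (u' x)]
      have h5 : |x * u' x - t * w x| ≤ t * (|x * u' x - t * w x| * (2 * r)) := by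
        nlinarith [abs_nonneg (x * u' x - t * w x)]
      have h6 : t * |w x| ≤ t * ((|u' x| + |x * u' x - t * w x|) * (2 * r)) := by linarith
      have h7 := le_of_mul_le_mul_left h6 ht0
      nlinarith [abs_nonneg (w x)]
  rw [amplitude, norm_mul, norm_mul, norm_cexp_I_mul_ofReal, Complex.norm_real, one_mul,
    Real.norm_of_nonneg (by positivity), inv_mul_le_iff₀ (by positivity)]
  refine hn.trans ?_
  rw [envelope]
  linarith

end

section

variable {t X r R : ℝ} {w u u' : ℝ → ℝ}

lemma continuousOn_amplitudeDeriv (h : Profile t X w u u') (ht : 1 ≤ t) (hr : 0 < r)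
    (hR : 0 < R) (hRa : R ≤ t * r ^ 2) :
    ContinuousOn (amplitudeDeriv t r w u u')
      (Icc (-(t * r ^ 2) - R / 2) (-(t * r ^ 2) + R / 2)) := by
  have h1 := h.continuous_w
  have h2 := h.continuous_u
  have h3 := h.continuous_deriv
  have hc : Continuous (halfPhase t) := by unfold halfPhase; fun_prop
  unfold amplitudeDeriv
  refine ContinuousOn.mul ?_ (Continuous.continuousOn (by fun_prop))
  refine Complex.continuous_ofReal.comp_continuousOn (ContinuousOn.inv₀ (by fun_prop) ?_)
  intro x hx
  have := (halfPhase_bounds ht hr hR hRa hx).2.1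
  have htr : 0 < t * r := by positivity
  have : 0 < halfPhase t x := by linarith
  positivity

/-- The variation of the amplitude over the support of the wave packet. -/
lemma Profile.norm_amplitude_sub_le (h : Profile t X w u u') (ht : 1 ≤ t) (hr : 0 < r)
    (hR : 0 < R) (hRa : R ≤ t * r ^ 2) {x y : ℝ}
    (hx : x ∈ Icc (-(t * r ^ 2) - R / 2) (-(t * r ^ 2) + R / 2))
    (hy : y ∈ Icc (-(t * r ^ 2) - R / 2) (-(t * r ^ 2) + R / 2)) :
    ‖amplitude t r w u x - amplitude t r w u y‖ ≤ (t * r ^ 2)⁻¹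
      * ∫ z in (-(t * r ^ 2) - R / 2)..(-(t * r ^ 2) + R / 2), envelope t w u u' z := by
  wlog hxy : y ≤ x generalizing x y
  · rw [norm_sub_rev]; exact this hy hx (le_of_not_ge hxy)
  have hsub : uIcc y x ⊆ Icc (-(t * r ^ 2) - R / 2) (-(t * r ^ 2) + R / 2) := by
    rw [uIcc_of_le hxy]; exact Icc_subset_Icc hy.1 hx.2
  have hc := continuousOn_amplitudeDeriv h ht hr hR hRa
  have hE := h.continuous_envelope
  have hftc := intervalIntegral.integral_eq_sub_of_hasDerivAt
    (f := amplitude t r w u) (f' := amplitudeDeriv t r w u u') (a := y) (b := x)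
    (fun z hz => h.hasDerivAt_amplitude (by linarith) hr
      (halfPhase_bounds ht hr hR hRa (hsub hz)).1) (hc.mono hsub).intervalIntegrable
  rw [← hftc, ← intervalIntegral.integral_const_mul]
  refine (intervalIntegral.norm_integral_le_integral_norm hxy).trans ?_
  calc ∫ z in y..x, ‖amplitudeDeriv t r w u u' z‖
      ≤ ∫ z in y..x, (t * r ^ 2)⁻¹ * envelope t w u u' z := by
        refine intervalIntegral.integral_mono_on hxy (hc.mono hsub).norm.intervalIntegrable
          (Continuous.intervalIntegrable (by fun_prop) _ _) fun z hz => ?_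
        exact norm_amplitudeDeriv_le ht hr hR hRa (hsub (by rwa [uIcc_of_le hxy]))
    _ ≤ _ := by
        refine intervalIntegral.integral_mono_interval hy.1 hxy hx.2
          (Filter.Eventually.of_forall fun z => ?_) (Continuous.intervalIntegrable (by fun_prop) _ _)
        exact mul_nonneg (by positivity) (envelope_nonneg _ _ _ _ _)

/-- A pointwise value of `B` is its mean over the packet interval plus its variation there; `R ≤ t
r²` lets the mean absorb the variation. -/
lemma Profile.norm_amplitude_le_average (h : Profile t X w u u') (ht : 1 ≤ t) (hr : 0 < r)
    (hR : 0 < R) (hRa : R ≤ t * r ^ 2) (htr : 1 ≤ t * r) {x : ℝ}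
    (hx : x ∈ Icc (-(t * r ^ 2) - R / 2) (-(t * r ^ 2) + R / 2)) :
    ‖amplitude t r w u x‖ ≤ 2 / R
      * ∫ z in (-(t * r ^ 2) - R / 2)..(-(t * r ^ 2) + R / 2), envelope t w u u' z := by
  set S := ∫ z in (-(t * r ^ 2) - R / 2)..(-(t * r ^ 2) + R / 2), envelope t w u u' z with hS
  have hab : -(t * r ^ 2) - R / 2 ≤ -(t * r ^ 2) + R / 2 := by linarith
  have hE := h.continuous_envelope
  have hS0 : 0 ≤ S := intervalIntegral.integral_nonneg hab fun z _ => envelope_nonneg _ _ _ _ _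
  have h1 : ∫ z in (-(t * r ^ 2) - R / 2)..(-(t * r ^ 2) + R / 2), ‖amplitude t r w u x‖
      ≤ ∫ z in (-(t * r ^ 2) - R / 2)..(-(t * r ^ 2) + R / 2),
        ((t * r ^ 2)⁻¹ * S + envelope t w u u' z) := by
    refine intervalIntegral.integral_mono_on hab (by simp)
      (Continuous.intervalIntegrable (by fun_prop) _ _) fun z hz => ?_
    have h2 := h.norm_amplitude_sub_le ht hr hR hRa hx hz
    have h3 := norm_amplitude_le (u' := u') (w := w) (u := u) ht hr hR hRa htr hz
    have h4 := norm_sub_norm_le (amplitude t r w u x) (amplitude t r w u z)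
    linarith
  rw [intervalIntegral.integral_add (by simp) (hE.intervalIntegrable _ _), ← hS] at h1
  simp only [intervalIntegral.integral_const, smul_eq_mul] at h1
  have h5 : (t * r ^ 2)⁻¹ ≤ R⁻¹ := inv_anti₀ hR hRa
  have h6 : R * ((t * r ^ 2)⁻¹ * S) ≤ S := by
    calc R * ((t * r ^ 2)⁻¹ * S) ≤ R * (R⁻¹ * S) := by gcongr
      _ = S := by field_simp
  rw [div_mul_eq_mul_div, le_div_iff₀ hR]
  nlinarith

/-! ### Testing against wave packets -/

/-- Testing against a wave packet recovers the amplitude at its centre. -/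
theorem Profile.norm_packet_sub_amplitude_le (h : Profile t X w u u') (ht : 1 ≤ t)
    (hr : 0 < r) (hR : 0 < R) (hRa : R ≤ t * r ^ 2) (hR2 : R ^ 2 = t * r ^ 3)
    {η η' : ℝ → ℂ} {M M' : ℝ} (hη : ∀ x, HasDerivAt η (η' x) x) (hη' : Continuous η')
    (hM : ∀ x, ‖η x‖ ≤ M) (hM' : ∀ x, ‖η' x‖ ≤ M') (h0 : η (-(1 / 2)) = 0) (h1 : η (1 / 2) = 0)
    (hint : ∫ x in (-(1 / 2) : ℝ)..(1 / 2), η x = 1) :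
    ‖((R⁻¹ : ℝ) : ℂ) * (∫ x in (-(t * r ^ 2) - R / 2)..(-(t * r ^ 2) + R / 2),
        η ((x + t * r ^ 2) / R)
          * (u x * Complex.exp (Complex.I * ((2 * halfPhase t x : ℝ) : ℂ))))
        - Complex.I * amplitude t r w u (-(t * r ^ 2))‖
      ≤ 20 * (M + M') * X * (√R / (t * r ^ 2)) := by
  have ht0 : 0 < t := by linarith
  -- From `R² = t r³` and `R ≤ t r²`: `t r³ ≤ t² r⁴`.
  have htr : 1 ≤ t * r := by
    have : t * r ^ 3 ≤ (t * r ^ 2) ^ 2 := by rw [← hR2]; gcongr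
    have h3 : 0 < t * r ^ 3 := by positivity
    by_contra hlt
    nlinarith
  set x₀ := -(t * r ^ 2) with hx₀
  set p₁ := x₀ - R / 2 with hp₁
  set p₂ := x₀ + R / 2 with hp₂
  have h12 : p₁ ≤ p₂ := by linarith
  set S := ∫ z in p₁..p₂, envelope t w u u' z with hS
  have hS4 : S ≤ 4 * X * √R := by
    have := h.integral_envelope_le p₁ p₂ h12
    rwa [show p₂ - p₁ = R by rw [hp₁, hp₂]; ring] at this
  have hS0 : 0 ≤ S := intervalIntegral.integral_nonneg h12 fun z _ => envelope_nonneg _ _ _ _ _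
  have hM0 : 0 ≤ M := (norm_nonneg _).trans (hM 0)
  have hM0' : 0 ≤ M' := (norm_nonneg _).trans (hM' 0)
  set B := amplitude t r w u with hB
  set B' := amplitudeDeriv t r w u u' with hB'
  have hBd : ∀ x ∈ Icc p₁ p₂, HasDerivAt B (B' x) x := fun x hx =>
    h.hasDerivAt_amplitude ht0 hr (halfPhase_bounds ht hr hR hRa hx).1
  have hBc : ContinuousOn B (Icc p₁ p₂) := fun x hx => (hBd x hx).continuousAt.continuousWithinAt
  have hBc' : ContinuousOn B' (Icc p₁ p₂) := continuousOn_amplitudeDeriv h ht hr hR hRa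
  have hBS : ∀ x ∈ Icc p₁ p₂, ‖B x‖ ≤ 2 / R * S := fun x hx =>
    h.norm_amplitude_le_average ht hr hR hRa htr hx
  have hx₀m : x₀ ∈ Icc p₁ p₂ := ⟨by linarith, by linarith⟩
  set c : ℝ → ℂ := fun x => η ((x + t * r ^ 2) / R) with hc
  have hcd : ∀ x, HasDerivAt c (((R⁻¹ : ℝ) : ℂ) * η' ((x + t * r ^ 2) / R)) x := by
    intro x
    have h2 : HasDerivAt (fun x : ℝ => (x + t * r ^ 2) / R) (1 / R) x :=
      ((hasDerivAt_id x).add_const _).div_const R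
    have h3 := (hη ((x + t * r ^ 2) / R)).scomp x h2
    rw [one_div, Complex.real_smul] at h3
    exact h3
  have hcc : Continuous c := continuous_iff_continuousAt.2 fun x => (hcd x).continuousAt
  have hcc' : Continuous fun x => ((R⁻¹ : ℝ) : ℂ) * η' ((x + t * r ^ 2) / R) := by fun_prop
  have hc1 : c p₁ = 0 := by
    rw [hc, ← h0]; beta_reduce; congr 1; rw [hp₁, hx₀]; field_simp; ring
  have hc2 : c p₂ = 0 := by
    rw [hc, ← h1]; beta_reduce; congr 1; rw [hp₂, hx₀]; field_simp; ring
  have hci : ∫ x in p₁..p₂, c x = R := by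
    have h2 := intervalIntegral.integral_comp_div_add (a := p₁) (b := p₂) η hR.ne' (t * r ^ 2 / R)
    have e1 : p₁ / R + t * r ^ 2 / R = -(1 / 2) := by rw [hp₁, hx₀]; field_simp; ring
    have e2 : p₂ / R + t * r ^ 2 / R = 1 / 2 := by rw [hp₂, hx₀]; field_simp; ring
    rw [e1, e2, hint] at h2
    simp only [hc, add_div]
    rw [h2]
    simp
  set e4 : ℝ → ℂ := fun x => Complex.exp (Complex.I * ((4 * halfPhase t x : ℝ) : ℂ)) with he4
  have he4n : ∀ x, ‖e4 x‖ = 1 := fun x => norm_cexp_I_mul_ofReal _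
  set k : ℝ → ℝ := fun x => t * r / halfPhase t x with hk
  have hph : Continuous (halfPhase t) := by unfold halfPhase; fun_prop
  have hp0 : ∀ x ∈ Icc p₁ p₂, 0 < halfPhase t x := fun x hx => by
    have := (halfPhase_bounds ht hr hR hRa hx).2.1
    have : 0 < t * r := by positivity
    linarith
  have hkc : ContinuousOn k (Icc p₁ p₂) :=
    continuousOn_const.div hph.continuousOn fun x hx => (hp0 x hx).ne'
  have hkc' : ContinuousOn (fun x => (k x : ℂ)) (Icc p₁ p₂) :=
    Complex.continuous_ofReal.comp_continuousOn hkc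
  have he4c : Continuous e4 := by rw [he4]; fun_prop
  have hu12 : uIcc p₁ p₂ = Icc p₁ p₂ := uIcc_of_le h12
  have hii : ∀ {f : ℝ → ℂ}, ContinuousOn f (Icc p₁ p₂) → IntervalIntegrable f volume p₁ p₂ :=
    fun hf => ContinuousOn.intervalIntegrable (by rwa [hu12])
  have hcB : ContinuousOn (fun x => conj (B x)) (Icc p₁ p₂) :=
    Complex.continuous_conj.comp_continuousOn hBc
  have hcB' : ContinuousOn (fun x => conj (B' x)) (Icc p₁ p₂) :=
    Complex.continuous_conj.comp_continuousOn hBc'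
  -- the resonant and non-resonant contributions
  have hsplit : (∫ x in p₁..p₂, c x
        * (u x * Complex.exp (Complex.I * ((2 * halfPhase t x : ℝ) : ℂ))))
      - R * (Complex.I * B x₀)
      = Complex.I * (∫ x in p₁..p₂, c x * (k x * B x - B x₀))
        - Complex.I * ∫ x in p₁..p₂, c x * conj (B x) * (k x * e4 x) := by
    have e1 : (R : ℂ) * (Complex.I * B x₀) = ∫ x in p₁..p₂, c x * (Complex.I * B x₀) := by
      rw [intervalIntegral.integral_mul_const, hci]
    have i1 : IntervalIntegrable (fun x => c x * (k x * B x - B x₀)) volume p₁ p₂ :=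
      hii (hcc.continuousOn.mul ((hkc'.mul hBc).sub continuousOn_const))
    have i2 : IntervalIntegrable (fun x => c x * conj (B x) * (k x * e4 x)) volume p₁ p₂ :=
      hii ((hcc.continuousOn.mul hcB).mul (hkc'.mul he4c.continuousOn))
    have i3 : IntervalIntegrable (fun x => c x
        * (u x * Complex.exp (Complex.I * ((2 * halfPhase t x : ℝ) : ℂ)))) volume p₁ p₂ := by
      have := h.continuous_u
      exact Continuous.intervalIntegrable (by fun_prop) _ _
    have i4 : IntervalIntegrable (fun x => c x * (Complex.I * B x₀)) volume p₁ p₂ :=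
      (hcc.mul continuous_const).intervalIntegrable _ _
    rw [e1, ← intervalIntegral.integral_sub i3 i4, ← mul_sub,
      ← intervalIntegral.integral_sub i1 i2, ← intervalIntegral.integral_const_mul]
    refine intervalIntegral.integral_congr fun x hx => ?_
    rw [hu12] at hx
    rw [ofReal_mul_cexp_eq ht0 hr w u (halfPhase_bounds ht hr hR hRa hx).1]
    ring
  have hmain : ‖∫ x in p₁..p₂, c x * (k x * B x - B x₀)‖
      ≤ M * (4 * ((t * r ^ 2)⁻¹ * S)) * R := by
    have hle : ∀ x ∈ uIoc p₁ p₂, ‖c x * (k x * B x - B x₀)‖ ≤ M * (4 * ((t * r ^ 2)⁻¹ * S)) := by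
      intro x hx
      have hx' : x ∈ Icc p₁ p₂ := by rw [← hu12]; exact uIoc_subset_uIcc hx
      obtain ⟨-, hb1, -, hb3⟩ := halfPhase_bounds ht hr hR hRa hx'
      have hk2 : |k x| ≤ 2 := by
        have : 0 < k x := div_pos (by positivity) (hp0 x hx')
        rw [abs_of_pos this, hk, div_le_iff₀ (hp0 x hx')]
        linarith
      -- Two sources of error: the variation of `B`, and the deviation of `tr/p` from `1`. Both
      -- contribute a multiple of `S / (t r²)`.
      have hdec : (k x : ℂ) * B x - B x₀
          = k x * (B x - B x₀) + ((k x - 1 : ℝ) : ℂ) * B x₀ := by push_cast; ring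
      have h5 : ‖(k x : ℂ) * B x - B x₀‖ ≤ 4 * ((t * r ^ 2)⁻¹ * S) := by
        rw [hdec]
        refine (norm_add_le _ _).trans ?_
        rw [norm_mul, norm_mul, Complex.norm_real, Complex.norm_real, Real.norm_eq_abs,
          Real.norm_eq_abs]
        calc |k x| * ‖B x - B x₀‖ + |k x - 1| * ‖B x₀‖
            ≤ 2 * ((t * r ^ 2)⁻¹ * S) + R / (t * r ^ 2) * (2 / R * S) := by
              gcongr
              · exact h.norm_amplitude_sub_le ht hr hR hRa hx' hx₀m
              · exact hBS x₀ hx₀m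
          _ = _ := by field_simp; ring
      rw [norm_mul]
      exact mul_le_mul (hM _) h5 (norm_nonneg _) hM0
    have := intervalIntegral.norm_integral_le_of_norm_le_const hle
    rwa [show p₂ - p₁ = R by rw [hp₁, hp₂]; ring, abs_of_pos hR] at this
  have hosc : ‖∫ x in p₁..p₂, c x * conj (B x) * (k x * e4 x)‖
      ≤ r / 2 * (M' * (2 / R * S) + M * ((t * r ^ 2)⁻¹ * S)) := by
    have hfd : ∀ x ∈ Icc p₁ p₂, HasDerivAt (fun x => c x * conj (B x))
        (((R⁻¹ : ℝ) : ℂ) * η' ((x + t * r ^ 2) / R) * conj (B x) + c x * conj (B' x)) x :=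
      fun x hx => (hcd x).mul
        ((Complex.conjCLE.toContinuousLinearMap.hasFDerivAt.comp_hasDerivAt x (hBd x hx)))
    -- The factor `k = tr/p` is, up to a constant, the derivative of the phase `4p`, so `k e4` has
    -- an explicit primitive of size `r/2`. Boundary terms vanish because the profile does.
    have hed : ∀ x ∈ Icc p₁ p₂, HasDerivAt (fun x => Complex.I * (r / 2) * e4 x)
        (k x * e4 x) x := by
      intro x hx
      have hx0 := (halfPhase_bounds ht hr hR hRa hx).1
      have h5 := (hasDerivAt_cexp_halfPhase 4 (mul_pos ht0 (by linarith : 0 < -x))).const_mul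
        (Complex.I * (r / 2))
      refine h5.congr_deriv ?_
      have hpC : (halfPhase t x : ℂ) ≠ 0 := by exact_mod_cast (hp0 x hx).ne'
      simp only [hk]
      push_cast
      field_simp
      simp only [Complex.I_sq, he4]
      push_cast
      ring_nf
    have hibp := intervalIntegral.integral_mul_deriv_eq_deriv_mul
      (u := fun x => c x * conj (B x)) (v := fun x => Complex.I * (r / 2) * e4 x) (a := p₁) (b := p₂)
      (u' := fun x => ((R⁻¹ : ℝ) : ℂ) * η' ((x + t * r ^ 2) / R) * conj (B x) + c x * conj (B' x))
      (v' := fun x => k x * e4 x)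
      (fun x hx => hfd x (by rwa [hu12] at hx)) (fun x hx => hed x (by rwa [hu12] at hx))
      (hii ((hcc'.continuousOn.mul hcB).add (hcc.continuousOn.mul hcB')))
      (hii (hkc'.mul he4c.continuousOn))
    rw [hibp, hc1, hc2, zero_mul, zero_mul, zero_mul, zero_mul, sub_self, zero_sub, norm_neg]
    refine (intervalIntegral.norm_integral_le_integral_norm h12).trans ?_
    have hE := h.continuous_envelope
    calc _ ≤ ∫ x in p₁..p₂, r / 2 * (R⁻¹ * M' * (2 / R * S)
          + M * ((t * r ^ 2)⁻¹ * envelope t w u u' x)) := by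
          refine intervalIntegral.integral_mono_on h12 ?_
            (Continuous.intervalIntegrable (by fun_prop) _ _) fun x hx => ?_
          · have hcont : ContinuousOn (fun x => ‖(((R⁻¹ : ℝ) : ℂ) * η' ((x + t * r ^ 2) / R)
                * conj (B x) + c x * conj (B' x)) * (Complex.I * (r / 2) * e4 x)‖) (Icc p₁ p₂) :=
              (((hcc'.continuousOn.mul hcB).add (hcc.continuousOn.mul hcB')).mul
                (continuousOn_const.mul he4c.continuousOn)).norm
            exact ContinuousOn.intervalIntegrable (by rwa [hu12])
          · have hr2 : ‖((r : ℂ) / 2)‖ = r / 2 := by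
              rw [norm_div, Complex.norm_real, Real.norm_of_nonneg hr.le]; simp
            rw [norm_mul, norm_mul, norm_mul, he4n, Complex.norm_I, hr2, mul_one, one_mul, mul_comm]
            refine mul_le_mul_of_nonneg_left ((norm_add_le _ _).trans ?_) (by positivity)
            rw [norm_mul, norm_mul, norm_mul, Complex.norm_real, RCLike.norm_conj, RCLike.norm_conj,
              Real.norm_of_nonneg (by positivity)]
            gcongr
            · exact hM' _
            · exact hBS x hx
            · exact hM _
            · exact norm_amplitudeDeriv_le ht hr hR hRa hx
      _ = _ := by
          rw [intervalIntegral.integral_const_mul, intervalIntegral.integral_add (by simp)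
            (Continuous.intervalIntegrable (by fun_prop) _ _)]
          simp only [intervalIntegral.integral_const_mul, intervalIntegral.integral_const, smul_eq_mul]
          rw [← hS]
          rw [show p₂ - p₁ = R by rw [hp₁, hp₂]; ring]
          field_simp
  have hRC : (R : ℂ) ≠ 0 := by exact_mod_cast hR.ne'
  have hfin : ((R⁻¹ : ℝ) : ℂ) * (∫ x in p₁..p₂, c x
        * (u x * Complex.exp (Complex.I * ((2 * halfPhase t x : ℝ) : ℂ)))) - Complex.I * B x₀
      = ((R⁻¹ : ℝ) : ℂ) * (Complex.I * (∫ x in p₁..p₂, c x * (k x * B x - B x₀))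
        - Complex.I * ∫ x in p₁..p₂, c x * conj (B x) * (k x * e4 x)) := by
    rw [← hsplit]; push_cast; field_simp
  rw [hfin, norm_mul, Complex.norm_real, Real.norm_of_nonneg (by positivity)]
  have htri : ‖Complex.I * (∫ x in p₁..p₂, c x * (k x * B x - B x₀))
        - Complex.I * ∫ x in p₁..p₂, c x * conj (B x) * (k x * e4 x)‖
      ≤ M * (4 * ((t * r ^ 2)⁻¹ * S)) * R
        + r / 2 * (M' * (2 / R * S) + M * ((t * r ^ 2)⁻¹ * S)) := by
    refine (norm_sub_le _ _).trans ?_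
    rw [norm_mul, norm_mul, Complex.norm_I, one_mul, one_mul]
    gcongr
  -- The scale `R² = t r³` is chosen so that the non-resonant gain `r/R` matches the relative width
  -- of the packet.
  have hrR : r / R = R / (t * r ^ 2) := by
    rw [div_eq_div_iff hR.ne' (by positivity), ← sq, hR2]; ring
  have hMinv : M * ((t * r ^ 2)⁻¹ * S) ≤ M * (2 / R * S) := by
    have : (t * r ^ 2)⁻¹ ≤ 2 / R := by
      rw [inv_le_comm₀ (by positivity) (by positivity), inv_div]
      linarith
    gcongr
  calc R⁻¹ * ‖Complex.I * (∫ x in p₁..p₂, c x * (k x * B x - B x₀))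
        - Complex.I * ∫ x in p₁..p₂, c x * conj (B x) * (k x * e4 x)‖
      ≤ R⁻¹ * (M * (4 * ((t * r ^ 2)⁻¹ * S)) * R
        + r / 2 * (M' * (2 / R * S) + M * (2 / R * S))) := by
        gcongr
        refine htri.trans ?_
        gcongr
    _ = M * (4 * ((t * r ^ 2)⁻¹ * S)) + (M' + M) * (R⁻¹ * (r / R) * S) := by
        field_simp
    _ = (5 * M + M') * ((t * r ^ 2)⁻¹ * S) := by
        rw [hrR]; field_simp; ring
    _ ≤ (5 * (M + M')) * ((t * r ^ 2)⁻¹ * (4 * X * √R)) := by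
        gcongr
        linarith
    _ = _ := by field_simp; ring

end

/-! ### The packet coefficient `γ` -/

lemma half_lt_two_rpow_neg_delta : (1 / 2 : ℝ) < 2 ^ (-delta) := by
  rw [one_div, ← Real.rpow_neg_one]
  exact Real.rpow_lt_rpow_of_exponent_lt (by norm_num) (by norm_num [delta])

section

variable {χ : ℝ → ℂ}

/-- This is all that is needed of `delta`: the packet lives strictly within `R/2` of its centre,
hence in `x < 0` whenever `R ≤ t|v|`. -/
lemma tsupport_subset_Ioo (hsupp : tsupport χ ⊆ Icc (-1 + (2 : ℝ) ^ (-delta))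
      (1 - (2 : ℝ) ^ (-delta))) : tsupport χ ⊆ Ioo (-(1 / 2)) (1 / 2) := by
  intro x hx
  have h1 := hsupp hx
  have h2 := half_lt_two_rpow_neg_delta
  constructor <;> linarith [h1.1, h1.2]

lemma phase_of_neg {t x : ℝ} (hx : x < 0) : phase t x = -2 * halfPhase t x := by
  rw [phase, halfPhase, abs_of_neg hx]

lemma conj_wavePacket (t v x : ℝ) :
    conj (wavePacket χ v t x) = ((|v| ^ (-(3 / 4) : ℝ) : ℝ) : ℂ)
      * conj (χ ((x - v * t) / (t ^ (1 / 2 : ℝ) * |v| ^ (3 / 4 : ℝ))))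
      * Complex.exp (Complex.I * ((-phase t x : ℝ) : ℂ)) := by
  rw [wavePacket, map_mul, map_mul, Complex.conj_ofReal, ← Complex.exp_conj, map_mul,
    Complex.conj_I, Complex.conj_ofReal]
  congr 2
  push_cast; ring

/-- `t^{-1/2} γ(t,v)` as an average over the support of the wave packet. -/
lemma rpow_mul_gamma_eq (hsupp : tsupport χ ⊆ Ioo (-(1 / 2)) (1 / 2)) (u : ℝ → ℝ → ℝ)
    {t r R : ℝ} (ht : 1 ≤ t) (hr : 0 < r) (hR : R = t ^ (1 / 2 : ℝ) * (r ^ 2) ^ (3 / 4 : ℝ))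
    (hRa : R ≤ t * r ^ 2) :
    ((t ^ (-(1 / 2) : ℝ) : ℝ) : ℂ) * gamma χ u t (-r ^ 2)
      = ((R⁻¹ : ℝ) : ℂ) * ∫ x in (-(t * r ^ 2) - R / 2)..(-(t * r ^ 2) + R / 2),
        conj (χ ((x + t * r ^ 2) / R))
          * (u t x * Complex.exp (Complex.I * ((2 * halfPhase t x : ℝ) : ℂ))) := by
  have ht0 : 0 < t := by linarith
  have hR0 : 0 < R := by rw [hR]; positivity
  have habs : |(-r ^ 2)| = r ^ 2 := by rw [abs_neg, abs_of_pos (by positivity)]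
  have hR' : R⁻¹ = t ^ (-(1 / 2) : ℝ) * (r ^ 2) ^ (-(3 / 4) : ℝ) := by
    rw [hR, Real.rpow_neg ht0.le, Real.rpow_neg (by positivity), mul_inv]
  rw [intervalIntegral.integral_eq_integral_of_support_subset]
  · rw [gamma, hR', Complex.ofReal_mul, mul_assoc]
    congr 1
    rw [← integral_const_mul]
    refine integral_congr_ae (Filter.Eventually.of_forall fun x => ?_)
    beta_reduce
    rw [conj_wavePacket, habs, ← hR, show x - -r ^ 2 * t = x + t * r ^ 2 by ring]
    -- The formula for the phase through `halfPhase` is used only for `x < 0`, which holds wherever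
    -- the profile is nonzero.
    by_cases hx : χ ((x + t * r ^ 2) / R) = 0
    · simp [hx]
    · have hx1 := hsupp (subset_tsupport χ hx)
      have hx2 : x < 0 := by
        have := hx1.2
        rw [div_lt_iff₀ hR0] at this
        linarith [mul_pos ht0 (by positivity : 0 < r ^ 2)]
      rw [phase_of_neg hx2, neg_mul, neg_neg]
      ring
  · intro x hx
    have hx0 : χ ((x + t * r ^ 2) / R) ≠ 0 := fun h0 => hx (by simp [h0])
    have hx1 := hsupp (subset_tsupport χ hx0)
    rw [mem_Ioo, lt_div_iff₀ hR0, div_lt_iff₀ hR0] at hx1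
    constructor <;> linarith [hx1.1, hx1.2]

lemma exists_bounds (hχ : ContDiff ℝ ∞ χ) (hsupp : tsupport χ ⊆ Ioo (-(1 / 2)) (1 / 2)) :
    ∃ M M' : ℝ, (∀ x, ‖χ x‖ ≤ M) ∧ ∀ x, ‖deriv χ x‖ ≤ M' := by
  have hcpt : HasCompactSupport χ :=
    HasCompactSupport.of_support_subset_isCompact (isCompact_Icc (a := (-(1 / 2) : ℝ)) (b := 1 / 2))
      ((subset_tsupport χ).trans (hsupp.trans Ioo_subset_Icc_self))
  obtain ⟨M, hM⟩ := hcpt.exists_bound_of_continuous hχ.continuous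
  obtain ⟨M', hM'⟩ := hcpt.deriv.exists_bound_of_continuous (hχ.continuous_deriv (by simp))
  exact ⟨M, M', hM, hM'⟩

lemma integral_conj_eq_one (hsupp : tsupport χ ⊆ Ioo (-(1 / 2)) (1 / 2))
    (hint : ∫ x : ℝ, χ x = 1) : ∫ x in (-(1 / 2) : ℝ)..(1 / 2), conj (χ x) = 1 := by
  rw [intervalIntegral.integral_eq_integral_of_support_subset, integral_conj, hint, map_one]
  intro x hx
  have hx0 : χ x ≠ 0 := fun h0 => hx (by simp [h0])
  exact Ioo_subset_Ioc_self (hsupp (subset_tsupport χ hx0))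

/-- The wave packet coefficient determines `w` and `u` at the centre of the packet. -/
lemma exists_packet_approximation (hχ : ContDiff ℝ ∞ χ)
    (hsupp : tsupport χ ⊆ Ioo (-(1 / 2)) (1 / 2)) (hint : ∫ x : ℝ, χ x = 1) :
    ∃ K : ℝ, 0 ≤ K ∧ ∀ (u : ℝ → ℝ → ℝ) (t X r : ℝ) (w u' : ℝ → ℝ), Profile t X w (u t) u' → 0 ≤ X →
      1 ≤ t → 0 < r → 1 ≤ t * r ^ 2 →
      ‖((t ^ (-(1 / 2) : ℝ) : ℝ) : ℂ)
          * (Complex.exp (Complex.I * (phase t (-(t * r ^ 2)) : ℂ)) * gamma χ u t (-r ^ 2))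
          - (u t (-(t * r ^ 2)) + Complex.I * (w (-(t * r ^ 2)) / r)) / 2‖
        ≤ K * X * (t ^ (-(3 / 4) : ℝ) * (r ^ 2) ^ (-(5 / 8) : ℝ)) := by
  obtain ⟨M, M', hM, hM'⟩ := exists_bounds hχ hsupp
  have hM0 : 0 ≤ M := (norm_nonneg _).trans (hM 0)
  have hM0' : 0 ≤ M' := (norm_nonneg _).trans (hM' 0)
  refine ⟨20 * (M + M'), by positivity, fun u t X r w u' h hX ht hr hta => ?_⟩
  have ht0 : 0 < t := by linarith
  have hr2 : 0 < r ^ 2 := by positivity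
  set R := t ^ (1 / 2 : ℝ) * (r ^ 2) ^ (3 / 4 : ℝ) with hR
  have hR0 : 0 < R := by positivity
  have hR2 : R ^ 2 = t * r ^ 3 := by
    rw [hR, mul_pow, ← Real.rpow_natCast (t ^ _), ← Real.rpow_mul ht0.le,
      ← Real.rpow_natCast r 2, ← Real.rpow_mul hr.le, ← Real.rpow_natCast (r ^ _),
      ← Real.rpow_mul hr.le, ← Real.rpow_natCast r 3]
    norm_num
  have hRa : R ≤ t * r ^ 2 := by
    refine (sq_le_sq₀ hR0.le (by positivity)).1 ?_
    rw [hR2]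
    have h1 : 1 ≤ t * r := by
      by_contra hlt
      nlinarith
    nlinarith [mul_pos ht0 (pow_pos hr 3)]
  have hzero : ∀ x, x ∉ Ioo (-(1 / 2) : ℝ) (1 / 2) → χ x = 0 := fun x hx =>
    image_eq_zero_of_notMem_tsupport fun hx' => hx (hsupp hx')
  have hηd : ∀ x, HasDerivAt (fun x => conj (χ x)) (conj (deriv χ x)) x := fun x =>
    Complex.conjCLE.toContinuousLinearMap.hasFDerivAt.comp_hasDerivAt x
      ((hχ.differentiable (by simp)) x).hasDerivAt
  have key := h.norm_packet_sub_amplitude_le (R := R) (M := M) (M' := M') ht hr hR0 hRa hR2 hηd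
    (Complex.continuous_conj.comp (hχ.continuous_deriv (by simp)))
    (fun x => by simpa using hM x) (fun x => by simpa using hM' x)
    (by simp [hzero]) (by simp [hzero]) (integral_conj_eq_one hsupp hint)
  rw [← rpow_mul_gamma_eq hsupp u ht hr hR hRa] at key
  have hx0 : -(t * r ^ 2) < 0 := by linarith
  have hp0 : halfPhase t (-(t * r ^ 2)) = t * r := by
    rw [halfPhase, neg_neg, show t * (t * r ^ 2) = (t * r) ^ 2 by ring,
      Real.sqrt_sq (by positivity)]
  -- The two exponentials cancel because `p = tr` at the centre, leaving the complex number that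
  -- encodes both `u` and `w`.
  have hB : Complex.exp (Complex.I * (phase t (-(t * r ^ 2)) : ℂ))
      * (Complex.I * amplitude t r w (u t) (-(t * r ^ 2)))
      = (u t (-(t * r ^ 2)) + Complex.I * (w (-(t * r ^ 2)) / r)) / 2 := by
    have he : Complex.exp (Complex.I * ((-2 * (t * r) : ℝ) : ℂ))
        * Complex.exp (Complex.I * ((2 * (t * r) : ℝ) : ℂ)) = 1 := by
      rw [← Complex.exp_add, ← mul_add, ← Complex.ofReal_add]; simp
    rw [phase_of_neg hx0, amplitude, hp0]
    have hrC : (r : ℂ) ≠ 0 := by exact_mod_cast hr.ne'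
    have htC : (t : ℂ) ≠ 0 := by exact_mod_cast ht0.ne'
    set e1 := Complex.exp (Complex.I * ((-2 * (t * r) : ℝ) : ℂ))
    set e2 := Complex.exp (Complex.I * ((2 * (t * r) : ℝ) : ℂ))
    set w0 := w (-(t * r ^ 2))
    set u0 := u t (-(t * r ^ 2))
    have : e1 * (Complex.I * ((((2 * r)⁻¹ : ℝ) : ℂ)
        * (e2 * (w0 - Complex.I * ((u0 * (t * r) / t : ℝ) : ℂ)))))
        = (e1 * e2) * (Complex.I * ((((2 * r)⁻¹ : ℝ) : ℂ)
        * (w0 - Complex.I * ((u0 * (t * r) / t : ℝ) : ℂ)))) := by ring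
    rw [this, he]
    push_cast
    field_simp
    ring_nf
    simp only [Complex.I_sq]
    ring
  have hE : √R / (t * r ^ 2) = t ^ (-(3 / 4) : ℝ) * (r ^ 2) ^ (-(5 / 8) : ℝ) := by
    rw [hR, Real.sqrt_eq_rpow, Real.mul_rpow (by positivity) (by positivity),
      ← Real.rpow_mul ht0.le, ← Real.rpow_mul hr2.le, mul_div_mul_comm]
    nth_rw 2 [← Real.rpow_one t]
    nth_rw 2 [← Real.rpow_one (r ^ 2)]
    rw [← Real.rpow_sub ht0, ← Real.rpow_sub hr2]
    norm_num
  rw [hE] at key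
  refine le_trans (le_of_eq ?_) key
  rw [← hB, mul_left_comm, ← mul_sub, norm_mul, norm_cexp_I_mul_ofReal, one_mul]

lemma aestronglyMeasurable_gamma (hχ : Continuous χ) (u : ℝ → ℝ → ℝ) (t : ℝ)
    (hu : AEStronglyMeasurable (u t) volume) :
    AEStronglyMeasurable (fun v : ℝ => gamma χ u t v) (volume.restrict (Iio (0 : ℝ))) := by
  have h1 : AEStronglyMeasurable (fun z : ℝ × ℝ => (u t z.2 : ℂ) * conj (wavePacket χ z.1 t z.2))
      ((volume.restrict (Iio (0 : ℝ))).prod volume) := by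
    refine AEStronglyMeasurable.mul ?_ (Measurable.aestronglyMeasurable ?_)
    · exact Complex.continuous_ofReal.comp_aestronglyMeasurable hu.comp_snd
    · refine Complex.continuous_conj.measurable.comp ?_
      have := hχ.measurable
      unfold wavePacket phase
      fun_prop
  exact h1.integral_prod_right'

/-- The packet has `L¹` norm `t^{1/2} ‖χ‖_{L¹}` for every `v`: the width contributes `|v|^{3/4}`,
which the prefactor removes. -/
lemma norm_gamma_le (hχ : Continuous χ) (hsupp : tsupport χ ⊆ Ioo (-(1 / 2)) (1 / 2))
    (u : ℝ → ℝ → ℝ) {t v : ℝ} (ht : 1 ≤ t) (hv : v < 0) (hu : MemLp (u t) ⊤ volume) :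
    ‖gamma χ u t v‖ ≤ (∫ x, ‖χ x‖) * t ^ (1 / 2 : ℝ) * (eLpNorm (u t) ⊤ volume).toReal := by
  have ht0 : 0 < t := by linarith
  have ha : 0 < |v| := abs_pos.2 hv.ne
  set N := (eLpNorm (u t) ⊤ volume).toReal with hN
  set R := t ^ (1 / 2 : ℝ) * |v| ^ (3 / 4 : ℝ) with hR
  have hR0 : 0 < R := by positivity
  have hcpt : HasCompactSupport χ :=
    HasCompactSupport.of_support_subset_isCompact (isCompact_Icc (a := (-(1 / 2) : ℝ)) (b := 1 / 2))
      ((subset_tsupport χ).trans (hsupp.trans Ioo_subset_Icc_self))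
  have hi : Integrable (fun x => ‖χ x‖) volume := (hχ.integrable_of_hasCompactSupport hcpt).norm
  have hae : ∀ᵐ x, ‖u t x‖ ≤ N := by
    filter_upwards [ae_le_eLpNormEssSup (f := u t) (μ := volume)] with x hx
    rw [← toReal_enorm]
    refine ENNReal.toReal_mono hu.eLpNorm_ne_top ?_
    rwa [eLpNorm_exponent_top]
  have hi2 : Integrable (fun x => ‖χ ((x - v * t) / R)‖) volume :=
    (hi.comp_div hR0.ne').comp_sub_right (v * t)
  calc ‖gamma χ u t v‖
      ≤ ∫ x, N * (|v| ^ (-(3 / 4) : ℝ) * ‖χ ((x - v * t) / R)‖) := by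
        rw [gamma]
        refine norm_integral_le_of_norm_le ((hi2.const_mul _).const_mul _) ?_
        filter_upwards [hae] with x hx
        rw [norm_mul, RCLike.norm_conj, wavePacket, norm_mul, norm_mul, norm_cexp_I_mul_ofReal,
          mul_one, Complex.norm_real, Complex.norm_real,
          Real.norm_of_nonneg (Real.rpow_nonneg (abs_nonneg v) _)]
        gcongr
    _ = N * (|v| ^ (-(3 / 4) : ℝ) * (R * ∫ x, ‖χ x‖)) := by
        rw [integral_const_mul, integral_const_mul,
          integral_sub_right_eq_self (fun x => ‖χ (x / R)‖) (v * t),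
          Measure.integral_comp_div (fun x => ‖χ x‖) R, abs_of_pos hR0, smul_eq_mul]
    _ = _ := by
        have : |v| ^ (-(3 / 4) : ℝ) * R = t ^ (1 / 2 : ℝ) := by
          rw [hR, mul_left_comm, ← Real.rpow_add ha]; simp
        rw [← mul_assoc (|v| ^ _), this]; ring

end

end ShortPulse

end

/-! ### Assembling the estimates -/

theorem proposition4p2 (χ : ℝ → ℂ) (hχ : ContDiff ℝ ∞ χ)
    (hsupp : tsupport χ ⊆ Icc (-1 + (2 : ℝ) ^ (-ShortPulse.delta))
      (1 - (2 : ℝ) ^ (-ShortPulse.delta)))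
    (hint : ∫ x : ℝ, χ x = 1) :
    (∃ C : ℝ, 0 < C ∧ ∀ (u : ℝ → ℝ → ℝ) (t : ℝ), 1 ≤ t → MemLp (u t) ⊤ (volume : Measure ℝ) →
      MemLp (fun v : ℝ => ShortPulse.gamma χ u t v) ⊤ (volume.restrict (Iio (0 : ℝ))) ∧
      eLpNorm (fun v : ℝ => ShortPulse.gamma χ u t v) ⊤ (volume.restrict (Iio (0 : ℝ)))
        ≤ ENNReal.ofReal (C * t ^ (1 / 2 : ℝ)) * eLpNorm (u t) ⊤ (volume : Measure ℝ)) ∧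
    (∀ s α : ℝ, 5 / 2 < s → 0 < α → α < 2 / (2 * s - 1) →
      ∃ C : ℝ, 0 < C ∧ ∀ (u : ℝ → ℝ → ℝ) (t : ℝ), 1 ≤ t → ShortPulse.MemX s t (u t) →
        ∀ v ∈ ShortPulse.Omega α t,
          |u t (v * t) - 2 * t ^ (-(1 / 2) : ℝ)
              * (Complex.exp (Complex.I * (ShortPulse.phase t (v * t) : ℂ))
                  * ShortPulse.gamma χ u t v).re|
            ≤ C * (t ^ (-(3 / 4) : ℝ) * |v| ^ (-(5 / 8) : ℝ)
                + t ^ (-((2 * s - 1) / (2 * s + 2))) * (1 + Real.log t))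
              * (ShortPulse.xNorm s t (u t)).toReal ∧
          DifferentiableAt ℝ (u t) (v * t) ∧
          |deriv (u t) (v * t) - 2 * t ^ (-(1 / 2) : ℝ) * |v| ^ (-(1 / 2) : ℝ)
              * (Complex.I * Complex.exp (Complex.I * (ShortPulse.phase t (v * t) : ℂ))
                  * ShortPulse.gamma χ u t v).re|
            ≤ C * (t ^ (-(3 / 4) : ℝ) * |v| ^ (-(9 / 8) : ℝ)
                + t ^ (-((2 * s - 3) / (2 * s + 2))) * (1 + Real.log t))
              * (ShortPulse.xNorm s t (u t)).toReal) := by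
  have hsub := ShortPulse.tsupport_subset_Ioo hsupp
  refine ⟨⟨(∫ x, ‖χ x‖) + 1, by positivity, fun u t ht hu => ?_⟩, fun s α hs hα hαs => ?_⟩
  · have hle : eLpNorm (fun v : ℝ => ShortPulse.gamma χ u t v) ⊤ (volume.restrict (Iio (0 : ℝ)))
        ≤ ENNReal.ofReal (((∫ x, ‖χ x‖) + 1) * t ^ (1 / 2 : ℝ)) * eLpNorm (u t) ⊤ volume := by
      rw [← ENNReal.ofReal_toReal hu.eLpNorm_ne_top, ← ENNReal.ofReal_mul (by positivity),
        eLpNorm_exponent_top]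
      refine eLpNormEssSup_le_of_ae_bound ?_
      filter_upwards [ae_restrict_mem measurableSet_Iio] with v hv
      refine (ShortPulse.norm_gamma_le hχ.continuous hsub u ht hv hu).trans ?_
      gcongr
      linarith
    refine ⟨⟨ShortPulse.aestronglyMeasurable_gamma hχ.continuous u t hu.aestronglyMeasurable,
      hle.trans_lt ?_⟩, hle⟩
    exact ENNReal.mul_lt_top ENNReal.ofReal_lt_top hu.eLpNorm_lt_top
  obtain ⟨m, hm⟩ := exists_nat_ge (s + 1)
  obtain ⟨D, hD, hprof⟩ := ShortPulse.exists_profile (by linarith : 2 ≤ s) hm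
  obtain ⟨K, hK, hpacket⟩ := ShortPulse.exists_packet_approximation hχ hsub hint
  set K' : ℝ := 2 ^ m * (1 + m * (1 + m)) * 4 with hK'
  have hK0 : 0 ≤ K' := by positivity
  refine ⟨2 * K + D + K', by positivity, fun u t ht hu v hv => ?_⟩
  obtain ⟨w, u', h, hdiff⟩ := hprof t (u t) hu
  set X := (ShortPulse.xNorm s t (u t)).toReal with hX
  have hX0 : 0 ≤ X := ENNReal.toReal_nonneg
  obtain ⟨hv0, hv1, -⟩ := hv
  have ht0 : 0 < t := by linarith
  have hlog : 0 ≤ Real.log t := Real.log_nonneg ht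
  obtain ⟨r, hr, rfl⟩ : ∃ r : ℝ, 0 < r ∧ v = -r ^ 2 :=
    ⟨√(-v), Real.sqrt_pos.2 (by linarith), by rw [Real.sq_sqrt (by linarith)]; ring⟩
  rw [neg_neg] at hv1
  have hr2 : 0 < r ^ 2 := by positivity
  have habs : |(-r ^ 2)| = r ^ 2 := by rw [abs_neg, abs_of_pos hr2]
  have hxt : -r ^ 2 * t = -(t * r ^ 2) := by ring
  rw [habs, hxt]
  -- Since `s ≥ 2`, `s + 1 ≤ 2s - 1`; only this weaker bound on `α` enters below.
  have hα1 : α ≤ 2 / (s + 1) :=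
    hαs.le.trans (div_le_div_of_nonneg_left (by norm_num) (by linarith) (by linarith))
  have hα2 : 2 / (s + 1) ≤ 1 := (div_le_one (by linarith)).2 (by linarith)
  have htα : t * t ^ (-α) = t ^ (1 - α) := by
    rw [sub_eq_add_neg, Real.rpow_add ht0, Real.rpow_one]
  have hta' : t ^ (1 - α) ≤ t * r ^ 2 := by rw [← htα]; gcongr
  have hta : 1 ≤ t * r ^ 2 := (Real.one_le_rpow ht (by linarith)).trans hta'
  set x₀ := -(t * r ^ 2) with hx₀
  have hpk := hpacket u t X r w u' h hX0 ht hr hta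
  rw [← hx₀] at hpk
  set Z := Complex.exp (Complex.I * (ShortPulse.phase t x₀ : ℂ)) * ShortPulse.gamma χ u t (-r ^ 2)
    with hZ
  set Y : ℂ := ((t ^ (-(1 / 2) : ℝ) : ℝ) : ℂ) * Z
    - (u t x₀ + Complex.I * (w x₀ / r)) / 2 with hY
  have hYre : t ^ (-(1 / 2) : ℝ) * Z.re = Y.re + u t x₀ / 2 := by
    have h1 : ((u t x₀ + Complex.I * (w x₀ / r)) / 2 : ℂ).re = u t x₀ / 2 := by
      rw [show ((u t x₀ + Complex.I * (w x₀ / r)) / 2 : ℂ)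
        = ((u t x₀ / 2 : ℝ) : ℂ) + ((w x₀ / r / 2 : ℝ) : ℂ) * Complex.I by push_cast; ring]
      simp
    rw [hY, Complex.sub_re, h1, Complex.re_ofReal_mul]; ring
  have hYim : t ^ (-(1 / 2) : ℝ) * Z.im = Y.im + w x₀ / r / 2 := by
    have h1 : ((u t x₀ + Complex.I * (w x₀ / r)) / 2 : ℂ).im = w x₀ / r / 2 := by
      rw [show ((u t x₀ + Complex.I * (w x₀ / r)) / 2 : ℂ)
        = ((u t x₀ / 2 : ℝ) : ℂ) + ((w x₀ / r / 2 : ℝ) : ℂ) * Complex.I by push_cast; ring]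
      simp
    rw [hY, Complex.sub_im, h1, Complex.im_ofReal_mul]; ring
  have hYr := (Complex.abs_re_le_norm Y).trans hpk
  have hYi := (Complex.abs_im_le_norm Y).trans hpk
  refine ⟨?_, (h.hasDerivAt_u x₀).differentiableAt, ?_⟩
  · have e1 : u t x₀ - 2 * t ^ (-(1 / 2) : ℝ) * Z.re = -(2 * Y.re) := by
      rw [mul_assoc, hYre]; ring
    rw [e1, abs_neg, abs_mul, abs_two]
    calc 2 * |Y.re| ≤ 2 * (K * X * (t ^ (-(3 / 4) : ℝ) * (r ^ 2) ^ (-(5 / 8) : ℝ))) := by gcongr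
      _ = 2 * K * (t ^ (-(3 / 4) : ℝ) * (r ^ 2) ^ (-(5 / 8) : ℝ) + 0) * X := by ring
      _ ≤ _ := by
        gcongr
        · linarith
        · positivity
  -- With this `l`, the power `l^{s-3/2}` is exactly the target `t^{-(2s-3)/(2s+2)}`. The bound `α ≤
  -- 2/(s+1)` gives both `l² ≤ |v|` and the same target for the averaging error `l^{-1/2} / (t|v|)`.
  · set l := t ^ (-(1 / (s + 1))) with hl
    have hl0 : 0 < l := by positivity
    have hl1 : l ≤ 1 := by
      refine Real.rpow_le_one_of_one_le_of_nonpos ht ?_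
      have : 0 < 1 / (s + 1) := by positivity
      linarith
    have hla : l ^ 2 ≤ r ^ 2 := by
      refine le_trans ?_ hv1
      rw [hl, ← Real.rpow_natCast, ← Real.rpow_mul ht0.le]
      refine Real.rpow_le_rpow_of_exponent_le ht ?_
      have : -(1 / (s + 1)) * (2 : ℕ) = -(2 / (s + 1)) := by push_cast; ring
      rw [this]
      linarith
    have hH := h.abs_deriv_add_le_of_difference hX0 hr2 hta ht hl0 hl1
      fun y hy hyl => hdiff (r ^ 2) l y x₀ hl0 hla hy hyl
    rw [← hx₀, ← hK'] at hH
    set T := t ^ (-((2 * s - 3) / (2 * s + 2))) with hT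
    have hlT : l ^ (s - 3 / 2) = T := by
      rw [hl, hT, ← Real.rpow_mul ht0.le]
      congr 1
      field_simp
    have hlT' : l ^ (-(1 / 2) : ℝ) / (t * r ^ 2) ≤ T := by
      calc l ^ (-(1 / 2) : ℝ) / (t * r ^ 2) ≤ l ^ (-(1 / 2) : ℝ) / t ^ (1 - α) := by gcongr
        _ = t ^ (-(1 / (s + 1)) * (-(1 / 2)) - (1 - α)) := by
          rw [hl, ← Real.rpow_mul ht0.le, ← Real.rpow_sub ht0]
        _ ≤ T := by
          refine Real.rpow_le_rpow_of_exponent_le ht ?_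
          have : -(1 / (s + 1)) * (-(1 / 2)) - (1 - 2 / (s + 1))
              = -((2 * s - 3) / (2 * s + 2)) := by
            field_simp; ring
          linarith
    rw [hlT] at hH
    have hrr : (r ^ 2) ^ (-(1 / 2) : ℝ) = r⁻¹ := by
      rw [← Real.rpow_natCast, ← Real.rpow_mul hr.le]; norm_num [Real.rpow_neg_one]
    -- The imaginary part of `Y` measures `w`, and the term `w / r²` is traded for `-u'` at the cost
    -- of the quantity bounded in `hH`.
    have e1 : deriv (u t) x₀ - 2 * t ^ (-(1 / 2) : ℝ) * (r ^ 2) ^ (-(1 / 2) : ℝ)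
        * (Complex.I * Complex.exp (Complex.I * (ShortPulse.phase t x₀ : ℂ))
          * ShortPulse.gamma χ u t (-r ^ 2)).re
        = (u' x₀ + (r ^ 2)⁻¹ * w x₀) + 2 * (r ^ 2) ^ (-(1 / 2) : ℝ) * Y.im := by
      rw [(h.hasDerivAt_u x₀).deriv, mul_assoc Complex.I, ← hZ, Complex.I_mul_re, hrr]
      have : 2 * t ^ (-(1 / 2) : ℝ) * r⁻¹ * -Z.im = -(2 * r⁻¹ * (t ^ (-(1 / 2) : ℝ) * Z.im)) := by
        ring
      rw [this, hYim]
      field_simp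
      ring
    rw [e1]
    have h98 : (r ^ 2) ^ (-(1 / 2) : ℝ) * (r ^ 2) ^ (-(5 / 8) : ℝ) = (r ^ 2) ^ (-(9 / 8) : ℝ) := by
      rw [← Real.rpow_add hr2]; norm_num
    have hT0 : 0 ≤ T := by positivity
    calc _ ≤ |u' x₀ + (r ^ 2)⁻¹ * w x₀| + 2 * (r ^ 2) ^ (-(1 / 2) : ℝ) * |Y.im| := by
          refine (abs_add_le _ _).trans_eq ?_
          rw [abs_mul (2 * _), abs_of_nonneg (by positivity : 0 ≤ 2 * (r ^ 2) ^ (-(1 / 2) : ℝ))]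
      _ ≤ (D * T * X + K' * X * T) + 2 * (r ^ 2) ^ (-(1 / 2) : ℝ)
          * (K * X * (t ^ (-(3 / 4) : ℝ) * (r ^ 2) ^ (-(5 / 8) : ℝ))) := by
          gcongr
          refine hH.trans ?_
          gcongr
      _ = (2 * K * (t ^ (-(3 / 4) : ℝ) * (r ^ 2) ^ (-(9 / 8) : ℝ)) + (D + K') * T) * X := by
          rw [← h98]; ring
      _ ≤ ((2 * K + D + K') * (t ^ (-(3 / 4) : ℝ) * (r ^ 2) ^ (-(9 / 8) : ℝ))
          + (2 * K + D + K') * (T * (1 + Real.log t))) * X := by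
          -- The argument produces no logarithm; the factor is inserted only to match the stated
          -- bound.
          have : T ≤ T * (1 + Real.log t) := le_mul_of_one_le_right hT0 (by linarith)
          gcongr
          · linarith
          · linarith
      _ = _ := by ring
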